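/- For $f,g:\{-1,1\}^n\to\{-1,1\}$ let $\mathrm{dist}(f,g)=\Pr_{x}[f(x)\neq g(x)]$, with $x$ uniform on $\{-1,1\}^n$. A function $g:\{-1,1\}^n\to\{-1,1\}$ is a $k$-junta if there is a set of at most $k$ coordinates such that $g(x)$ depends only on these coordinates of $x$. A randomized query algorithm on $n$ variables has oracle access to an unknown $f:\{-1,1\}^n\to\{-1,1\}$, makes adaptive queries to $f$, and finally accepts or rejects; formally, it is a probability distribution over deterministic adaptive query algorithms (decision trees). There is a real polynomial $p$ in two variables such that the following holds for all real constants $\frac12>c_u>c_\ell\ge 0$ and every integer $k\ge 0$. There are an integer $q\ge 0$ with $$q\le 2^k\cdot p\bigl(k,\tfrac{1}{c_u-c_\ell}\bigr)$$ and, for each $n\ge 0$, a randomized query algorithm $T_n$ on $n$ variables that makes at most $q$ queries (for every oracle and every outcome of its randomness; $q$ does not depend on $n$) and is a $(c_u,c_\ell)$-noise tolerant tester for $k$-juntas, that is, for every $f:\{-1,1\}^n\to\{-1,1\}$: 1. if $\mathrm{dist}(f,g)\le c_\ell$ for some $k$-junta $g$, then $T_n$ accepts with probability at least $2/3$; 2.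 if $\mathrm{dist}(f,g)\ge c_u$ for every $k$-junta $g$, then $T_n$ rejects with probability at least $2/3$. -/

import Mathlib

namespace JuntaTesting

/-- The discrete cube `{-1, 1} ^ n`; the type `ℤˣ` consists of exactly `1` and `-1`. -/
abbrev Cube (n : ℕ) : Type := Fin n → ℤˣ

/-- Functions `{-1, 1} ^ n → {-1, 1}`. -/
abbrev BoolFun (n : ℕ) : Type := Cube n → ℤˣ

/-- `dist f g`: the probability that `f x ≠ g x` for a uniformly random point `x` of the cube. -/
noncomputable def dist {n : ℕ} (f g : BoolFun n) : ℝ :=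
  ((Finset.univ.filter fun x : Cube n => f x ≠ g x).card : ℝ) / (Fintype.card (Cube n) : ℝ)

/-- `g` depends only on the coordinates in `S`. -/
def DependsOnlyOn {n : ℕ} (g : BoolFun n) (S : Finset (Fin n)) : Prop :=
  ∀ x y : Cube n, (∀ i ∈ S, x i = y i) → g x = g y

/-- The class of `k`-juntas on `n` variables: functions that depend on at most `k` coordinates. -/
def juntas (n k : ℕ) : Set (BoolFun n) :=
  {g | ∃ S : Finset (Fin n), S.card ≤ k ∧ DependsOnlyOn g S}

/-- A deterministic adaptive query algorithm with oracle access to a function on the cube: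
either it stops with a verdict (`true`: accept, `false`: reject), or it queries the oracle at a
point and continues in a way that may depend on the answer. -/
inductive QueryTree (n : ℕ) : Type
  | verdict (b : Bool) : QueryTree n
  | query (x : Cube n) (next : ℤˣ → QueryTree n) : QueryTree n

/-- The verdict of a deterministic query algorithm when its oracle is `f`. -/
def QueryTree.run {n : ℕ} (f : BoolFun n) : QueryTree n → Bool
  | .verdict b => b
  | .query x next => (next (f x)).run f

/-- The number of oracle queries made when the oracle is `f`. -/
def QueryTree.queryCount {n : ℕ} (f : BoolFun n) : QueryTree n → ℕ
  | .verdict _ => 0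
  | .query x next => (next (f x)).queryCount f + 1

/-- A randomized adaptive query algorithm: a deterministic one drawn from a probability
distribution (the outcome of all internal coin tosses). -/
abbrev RandomizedQueryAlgorithm (n : ℕ) : Type := PMF (QueryTree n)

/-- The probability that the algorithm `T` ends with verdict `b` when its oracle is `f`. -/
noncomputable def RandomizedQueryAlgorithm.prob {n : ℕ} (T : RandomizedQueryAlgorithm n)
    (f : BoolFun n) (b : Bool) : ENNReal :=
  PMF.map (QueryTree.run f) T b

/-- `T` never makes more than `q` queries, whatever the oracle and the coin tosses. -/
def RandomizedQueryAlgorithm.MakesAtMost {n : ℕ} (T : RandomizedQueryAlgorithm n) (q : ℕ) : Prop :=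
  ∀ t ∈ PMF.support T, ∀ f : BoolFun n, t.queryCount f ≤ q

/-- `T` is a `(cu, cl)`-noise tolerant tester for the class `𝒞`. -/
def IsTolerantTester {n : ℕ} (cu cl : ℝ) (𝒞 : Set (BoolFun n))
    (T : RandomizedQueryAlgorithm n) : Prop :=
  ∀ f : BoolFun n,
    ((∃ g ∈ 𝒞, dist f g ≤ cl) → 2 / 3 ≤ T.prob f true) ∧
    ((∀ g ∈ 𝒞, cu ≤ dist f g) → 2 / 3 ≤ T.prob f false)

end JuntaTesting

/-! Since `𝔼 f g = 1 - 2 dist f g`, the task is to decide whether the best correlation of `f` with a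
`k`-junta is large or small. To keep the query count independent of `n`, the tester never identifies
coordinates. It works with random functions, computable from few values of `f`, some of which are
close to `x_i` or `-x_i`.

Such an approximate coordinate oracle (`gadget`) fixes the coordinates outside a random set `J` at
random, which leaves a function `h`, and averages `h` over the coordinates outside a sparse random
block `B`. The average is `∑ ĥ(T) χ_T` over `T ⊆ B`; given `i ∈ B`, every `T` other than `∅` and
`{i}` is unlikely to survive, so the average is nearly `ĥ(∅) + ĥ({i}) x_i`, and the sign of its odd
part is nearly `± x_i`. If `i` matters for correlation with a junta, then `ĥ({i})` is large in mean
square, and the oracle captures `i` with inverse polynomial probability (`le_pr_nearDictator`).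
Polynomially many oracles then capture all relevant coordinates; irrelevant ones are dropped from
the junta at a small loss (`exists_relevant_junta`).

Useless oracles are filtered out by a dictatorship test whose expected value on an odd function `G`
is `∑ 2^{-|S|} Ĝ(S)^3`. Only singletons have weight `1/2`, all larger odd levels at most `1/8`, so a
value near `1/2` forces closeness to a signed coordinate. Soundness does not care which coordinates
these are.

Finally, all functions of at most `k` surviving oracles are compared with `f` on one common sample.
There are at most `(L+1)^k 2^{2^k}` of them for `L` oracles, so an exponential tail bound and a
union bound ask for `2^k` times polynomially many points (`exp_deviation_le`). Each point costs
polynomially many queries, which gives the claimed form of the bound. -/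

namespace JuntaTesting

open scoped BigOperators

/-! ### Finite probability and concentration of empirical means. -/

section Expectation

/-- The indicator of a proposition, as a real number. -/
noncomputable def ind (p : Prop) : ℝ := open Classical in if p then 1 else 0

lemma ind_of {p : Prop} (h : p) : ind p = 1 := by simp [ind, h]

lemma ind_of_not {p : Prop} (h : ¬p) : ind p = 0 := by simp [ind, h]

lemma ind_nonneg (p : Prop) : 0 ≤ ind p := by unfold ind; split_ifs <;> norm_num

lemma ind_le_one (p : Prop) : ind p ≤ 1 := by unfold ind; split_ifs <;> norm_num

lemma ind_mono {p q : Prop} (h : p → q) : ind p ≤ ind q := by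
  by_cases hp : p
  · rw [ind_of hp, ind_of (h hp)]
  · rw [ind_of_not hp]; exact ind_nonneg q

lemma ind_or_le (p q : Prop) : ind (p ∨ q) ≤ ind p + ind q := by
  by_cases hp : p <;> by_cases hq : q <;> simp [ind, hp, hq]

lemma ind_not (p : Prop) : ind (¬p) = 1 - ind p := by
  by_cases hp : p <;> simp [ind, hp]

lemma ind_forall {ι : Type*} [Fintype ι] (p : ι → Prop) : ind (∀ i, p i) = ∏ i, ind (p i) := by
  by_cases h : ∀ i, p i
  · rw [ind_of h, Finset.prod_eq_one fun i _ => ind_of (h i)]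
  · rw [ind_of_not h]
    push Not at h
    obtain ⟨i, hi⟩ := h
    exact (Finset.prod_eq_zero (Finset.mem_univ i) (ind_of_not hi)).symm

lemma ind_exists_le {ι : Type*} [Fintype ι] (p : ι → Prop) :
    ind (∃ i, p i) ≤ ∑ i, ind (p i) := by
  by_cases h : ∃ i, p i
  · obtain ⟨i, hi⟩ := h
    rw [ind_of ⟨i, hi⟩, ← ind_of hi]
    exact Finset.single_le_sum (f := fun i => ind (p i)) (fun j _ => ind_nonneg _)
      (Finset.mem_univ i)
  · rw [ind_of_not h]; exact Finset.sum_nonneg fun j _ => ind_nonneg _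

/-- The probability of an event under the uniform distribution on a finite type. -/
noncomputable def pr {Ω : Type*} [Fintype Ω] (p : Ω → Prop) : ℝ := 𝔼 ω, ind (p ω)

variable {Ω Ω' : Type*} [Fintype Ω] [Fintype Ω']

lemma expect_mono {f g : Ω → ℝ} (h : ∀ ω, f ω ≤ g ω) : 𝔼 ω, f ω ≤ 𝔼 ω, g ω :=
  Finset.expect_le_expect fun ω _ => h ω

lemma expect_le_const [Nonempty Ω] {f : Ω → ℝ} {a : ℝ} (h : ∀ ω, f ω ≤ a) : 𝔼 ω, f ω ≤ a :=
  Finset.expect_le Finset.univ_nonempty fun ω _ => h ω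

lemma pr_mono {p q : Ω → Prop} (h : ∀ ω, p ω → q ω) : pr p ≤ pr q :=
  expect_mono fun ω => ind_mono (h ω)

lemma pr_or_le (p q : Ω → Prop) : pr (fun ω => p ω ∨ q ω) ≤ pr p + pr q := by
  unfold pr
  rw [← Finset.expect_add_distrib]
  exact expect_mono fun ω => ind_or_le _ _

lemma pr_exists_le {ι : Type*} [Fintype ι] (p : Ω → ι → Prop) :
    pr (fun ω => ∃ i, p ω i) ≤ ∑ i, pr (fun ω => p ω i) := by
  unfold pr
  rw [← Finset.expect_sum_comm]
  exact expect_mono fun ω => ind_exists_le _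

lemma pr_not [Nonempty Ω] (p : Ω → Prop) : pr (fun ω => ¬p ω) = 1 - pr p := by
  unfold pr
  simp only [ind_not, Finset.expect_sub_distrib]
  rw [Fintype.expect_const]

lemma expect_prod_type (f : Ω × Ω' → ℝ) : 𝔼 ω, f ω = 𝔼 a, 𝔼 b, f (a, b) := by
  rw [← Finset.univ_product_univ, Finset.expect_product]

lemma pr_prod_le [Nonempty Ω] (p : Ω × Ω' → Prop) {c : ℝ} (h : ∀ a, pr (fun b => p (a, b)) ≤ c) :
    pr p ≤ c := by
  unfold pr
  rw [expect_prod_type]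
  exact expect_le_const h

lemma pr_fst [Nonempty Ω'] (p : Ω → Prop) : pr (fun ω : Ω × Ω' => p ω.1) = pr p := by
  unfold pr
  rw [expect_prod_type]
  simp only [Fintype.expect_const]

lemma pr_le_of_sq {f : Ω → ℝ} {a c : ℝ} (ha : 0 < a) (h : 𝔼 ω, f ω ^ 2 ≤ c) :
    pr (fun ω => a ≤ |f ω|) ≤ c / a ^ 2 := by
  rw [le_div_iff₀ (by positivity)]
  refine le_trans ?_ h
  unfold pr
  rw [Finset.expect_mul]
  refine expect_mono fun ω => ?_
  by_cases hω : a ≤ |f ω|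
  · rw [ind_of hω, one_mul, ← sq_abs (f ω)]; gcongr
  · rw [ind_of_not hω, zero_mul]; positivity

variable {ι α : Type*} [Fintype ι] [DecidableEq ι] [Fintype α]

lemma expect_pi_prod (φ : ι → α → ℝ) :
    𝔼 x : ι → α, ∏ i, φ i (x i) = ∏ i, 𝔼 a, φ i a := by
  simp only [Fintype.expect_eq_sum_div_card, Finset.prod_div_distrib, Finset.prod_const,
    Finset.prod_univ_sum, Fintype.piFinset_univ]
  congr 1
  simp [Finset.card_univ]

lemma expect_pi_apply [Nonempty α] (F : α → ℝ) (t : ι) : 𝔼 x : ι → α, F (x t) = 𝔼 a, F a := by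
  have h := expect_pi_prod (fun (i : ι) a => if i = t then F a else (1 : ℝ))
  rw [Fintype.prod_eq_single t (fun i hi => by simp [hi])] at h
  simpa using h

lemma expect_pi_apply_mul [Nonempty α] (F G : α → ℝ) {s t : ι} (hst : s ≠ t) :
    𝔼 x : ι → α, F (x s) * G (x t) = (𝔼 a, F a) * 𝔼 a, G a := by
  have h := expect_pi_prod (fun (i : ι) a => if i = s then F a else if i = t then G a else (1 : ℝ))
  rw [Fintype.prod_eq_mul s t hst (fun i hi => by simp [hi.1, hi.2])] at h
  simp only [if_true, hst.symm, if_false] at h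
  rw [← h]
  refine Finset.expect_congr rfl fun x _ => ?_
  rw [Fintype.prod_eq_mul s t hst (fun i hi => by simp [hi.1, hi.2])]
  simp [hst.symm]

/-- The empirical mean of `F` over the sample `w`. -/
noncomputable def emp {M : ℕ} (F : α → ℝ) (w : Fin M → α) : ℝ := (∑ t, F (w t)) / M

/-- Bias plus variance: independence removes the covariances. Allowing `b` to differ from the mean
lets the same bound absorb the Fourier leakage in `expect_affineError_le`. -/
lemma expect_emp_sub_sq [Nonempty α] {M : ℕ} (hM : 0 < M) {F : α → ℝ} (hF : ∀ a, |F a| ≤ 1)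
    (b : ℝ) :
    𝔼 w : Fin M → α, (emp F w - b) ^ 2 ≤ 1 / M + (𝔼 a, F a - b) ^ 2 := by
  have hM' : (0 : ℝ) < M := by exact_mod_cast hM
  set μ := 𝔼 a, F a with hμ
  set G : α → ℝ := fun a => F a - b with hG
  have hGm : 𝔼 a, G a = μ - b := by
    simp only [hG, Finset.expect_sub_distrib, Fintype.expect_const, hμ]
  have hG2 : 𝔼 a, G a ^ 2 ≤ 1 + (μ - b) ^ 2 - μ ^ 2 := by
    have : ∀ a, G a ^ 2 = F a ^ 2 - 2 * b * F a + b ^ 2 := fun a => by simp only [hG]; ring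
    simp only [this, Finset.expect_add_distrib, Finset.expect_sub_distrib, Fintype.expect_const,
      ← Finset.mul_expect, ← hμ]
    have h1 : 𝔼 a, F a ^ 2 ≤ 1 := expect_le_const fun a => by
      rw [← sq_abs]; exact pow_le_one₀ (abs_nonneg _) (hF a)
    nlinarith
  have key : ∀ w : Fin M → α, (emp F w - b) ^ 2 = (∑ s, ∑ t, G (w s) * G (w t)) / M ^ 2 := by
    intro w
    have : emp F w - b = (∑ t, G (w t)) / M := by
      simp only [emp, hG, Finset.sum_sub_distrib, Finset.sum_const, Finset.card_univ,
        Fintype.card_fin, nsmul_eq_mul]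
      field_simp
    rw [this, div_pow, sq (∑ t, G (w t)), Finset.sum_mul_sum]
  simp only [key]
  rw [← Finset.expect_div, Finset.expect_sum_comm]
  simp only [Finset.expect_sum_comm]
  have hst : ∀ s t : Fin M, 𝔼 w : Fin M → α, G (w s) * G (w t) ≤
      (μ - b) ^ 2 + if s = t then 1 else 0 := by
    intro s t
    split_ifs with h
    · subst h
      have := expect_pi_apply (ι := Fin M) (fun a => G a * G a) s
      rw [this]
      simp only [← sq]
      nlinarith [sq_nonneg μ]
    · rw [expect_pi_apply_mul G G h, hGm, sq]; simp
  have : ∑ s : Fin M, ∑ t : Fin M, 𝔼 w : Fin M → α, G (w s) * G (w t) ≤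
      M ^ 2 * (μ - b) ^ 2 + M := by
    refine (Finset.sum_le_sum fun s _ => Finset.sum_le_sum fun t _ => hst s t).trans ?_
    simp only [Finset.sum_add_distrib, Finset.sum_ite_eq, Finset.mem_univ, if_true,
      Finset.sum_const, Finset.card_univ, Fintype.card_fin, nsmul_eq_mul]
    apply le_of_eq; ring
  rw [div_le_iff₀ (by positivity)]
  refine this.trans (le_of_eq ?_)
  field_simp
  ring

lemma pr_emp_dev [Nonempty α] {M : ℕ} (hM : 0 < M) {F : α → ℝ} (hF : ∀ a, |F a| ≤ 1) {a : ℝ}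
    (ha : 0 < a) : pr (fun w : Fin M → α => a ≤ |emp F w - 𝔼 b, F b|) ≤ 1 / (M * a ^ 2) := by
  have := expect_emp_sub_sq hM hF (𝔼 b, F b)
  rw [sub_self, zero_pow two_ne_zero, add_zero] at this
  exact (pr_le_of_sq ha this).trans (le_of_eq (by rw [div_div]))

lemma abs_expect_le_one [Nonempty α] {F : α → ℝ} (hF : ∀ a, |F a| ≤ 1) : |𝔼 a, F a| ≤ 1 :=
  (Finset.abs_expect_le _ _).trans (expect_le_const hF)

/-- Exponential moment method. Chebyshev's bound would be too weak for the union over doubly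
exponentially many composites. -/
lemma pr_emp_ge [Nonempty α] {M : ℕ} (hM : 0 < M) {F : α → ℝ} (hF : ∀ a, |F a| ≤ 1) {a : ℝ}
    (ha : 0 < a) (ha1 : a ≤ 4) :
    pr (fun w : Fin M → α => a ≤ emp F w - 𝔼 b, F b) ≤ Real.exp (-(M * a ^ 2 / 16)) := by
  have hM' : (0 : ℝ) < M := by exact_mod_cast hM
  set μ := 𝔼 b, F b with hμ
  have hμ1 : |μ| ≤ 1 := abs_expect_le_one hF
  -- As `a ≤ 4` and `|F - μ| ≤ 2`, this keeps `|s (F - μ)| ≤ 1`, where `exp t ≤ 1 + t + t ^ 2`; the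
  -- exponent per sample is then `-s a + 4 s ^ 2 = -a ^ 2 / 16`.
  set s : ℝ := a / 8 with hs
  have h1 : 𝔼 b, Real.exp (s * (F b - μ)) ≤ Real.exp (4 * s ^ 2) := by
    have hb : ∀ b, Real.exp (s * (F b - μ)) ≤ 1 + s * (F b - μ) + 4 * s ^ 2 := by
      intro b
      have h2 : |F b - μ| ≤ 2 := (abs_sub _ _).trans (by linarith [hF b])
      have h3 : |s * (F b - μ)| ≤ 1 := by
        rw [abs_mul, abs_of_pos (by positivity : 0 < s)]
        nlinarith [abs_nonneg (F b - μ)]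
      have h4 := (abs_le.1 (Real.abs_exp_sub_one_sub_id_le h3)).2
      have h5 : (F b - μ) ^ 2 ≤ 4 := by rw [← sq_abs]; nlinarith [abs_nonneg (F b - μ)]
      nlinarith [sq_nonneg s]
    refine (expect_mono hb).trans ?_
    rw [Finset.expect_add_distrib, Finset.expect_add_distrib, ← Finset.mul_expect,
      Finset.expect_sub_distrib, Fintype.expect_const, Fintype.expect_const, Fintype.expect_const,
      ← hμ, sub_self, mul_zero, add_zero]
    linarith [Real.add_one_le_exp (4 * s ^ 2)]
  have h2 : ∀ w : Fin M → α, ind (a ≤ emp F w - μ) ≤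
      Real.exp (-(s * a * M)) * ∏ t, Real.exp (s * (F (w t) - μ)) := by
    intro w
    rw [← Real.exp_sum, ← Real.exp_add]
    by_cases hw : a ≤ emp F w - μ
    · rw [ind_of hw]
      apply Real.one_le_exp
      rw [← Finset.mul_sum, Finset.sum_sub_distrib]
      simp only [Finset.sum_const, Finset.card_univ, Fintype.card_fin, nsmul_eq_mul]
      have : ∑ t, F (w t) = M * emp F w := by rw [emp]; field_simp
      rw [this]
      have : 0 ≤ s * M * (emp F w - μ - a) := by
        have : 0 < s := by positivity
        have := sub_nonneg.2 hw
        positivity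
      nlinarith
    · rw [ind_of_not hw]; positivity
  unfold pr
  refine (expect_mono h2).trans ?_
  rw [← Finset.mul_expect, expect_pi_prod (fun (_ : Fin M) b => Real.exp (s * (F b - μ)))]
  rw [Finset.prod_const, Finset.card_univ, Fintype.card_fin]
  refine (mul_le_mul_of_nonneg_left (pow_le_pow_left₀
    (Finset.expect_nonneg fun _ _ => (Real.exp_pos _).le) h1 M) (Real.exp_pos _).le).trans ?_
  rw [← Real.exp_nat_mul, ← Real.exp_add]
  apply Real.exp_le_exp.2
  rw [hs]
  apply le_of_eq; ring

lemma pr_emp_abs_ge [Nonempty α] {M : ℕ} (hM : 0 < M) {F : α → ℝ} (hF : ∀ a, |F a| ≤ 1) {a : ℝ}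
    (ha : 0 < a) (ha1 : a ≤ 4) :
    pr (fun w : Fin M → α => a ≤ |emp F w - 𝔼 b, F b|) ≤
      2 * Real.exp (-(M * a ^ 2 / 16)) := by
  have h1 := pr_emp_ge hM hF ha ha1
  have h2 := pr_emp_ge hM (F := fun b => -F b) (fun b => by rw [abs_neg]; exact hF b) ha ha1
  rw [two_mul]
  refine (pr_mono ?_).trans ((pr_or_le _ _).trans (add_le_add h1 h2))
  intro w hw
  rcases le_abs.1 hw with h | h
  · exact Or.inl h
  · right
    rw [Finset.expect_neg_distrib]
    have : emp (fun b => -F b) w = -emp F w := by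
      simp only [emp, Finset.sum_neg_distrib, neg_div]
    rw [this]; linarith

lemma pr_forall_pi (p : α → Prop) (L : ℕ) : pr (fun w : Fin L → α => ∀ t, p (w t)) = pr p ^ L := by
  unfold pr
  simp only [ind_forall]
  rw [expect_pi_prod (fun (_ : Fin L) a => ind (p a))]
  simp

lemma one_sub_pow_le {π : ℝ} (h0 : 0 < π) (h1 : π ≤ 1) {L : ℕ} (hL : 0 < L) :
    (1 - π) ^ L ≤ 1 / (π * L) := by
  have hL' : (0 : ℝ) < L := by exact_mod_cast hL
  have : (1 - π) ^ L ≤ Real.exp (-(π * L)) := by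
    have := pow_le_pow_left₀ (by linarith) (Real.one_sub_le_exp_neg π) L
    rwa [← Real.exp_nat_mul, mul_neg, mul_comm] at this
  refine this.trans ?_
  rw [Real.exp_neg, ← one_div]
  have : π * L ≤ Real.exp (π * L) := by linarith [Real.add_one_le_exp (π * L)]
  exact one_div_le_one_div_of_le (by positivity) this

lemma pr_pi_none_le [Nonempty α] {p : α → Prop} {π : ℝ} (h0 : 0 < π) (h : π ≤ pr p)
    {L : ℕ} (hL : 0 < L) : pr (fun w : Fin L → α => ∀ t, ¬p (w t)) ≤ 1 / (π * L) := by
  have h1 : pr p ≤ 1 := expect_le_const fun _ => ind_le_one _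
  rw [pr_forall_pi (fun a => ¬p a), pr_not]
  refine (pow_le_pow_left₀ (by linarith) (by linarith : 1 - pr p ≤ 1 - π) L).trans ?_
  exact one_sub_pow_le h0 (h.trans h1) hL

end Expectation

/-! ### Fourier–Walsh expansion on the cube. -/

section Fourier

/-- A sign as a real number. -/
def val (u : ℤˣ) : ℝ := ((u : ℤ) : ℝ)

@[simp] lemma val_one : val 1 = 1 := by simp [val]

@[simp] lemma val_neg (u : ℤˣ) : val (-u) = -val u := by simp [val]

@[simp] lemma val_mul (u v : ℤˣ) : val (u * v) = val u * val v := by simp [val]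

lemma val_cases (u : ℤˣ) : val u = 1 ∨ val u = -1 := by
  rcases Int.units_eq_one_or u with rfl | rfl <;> simp

@[simp] lemma val_mul_self (u : ℤˣ) : val u * val u = 1 := by
  rcases val_cases u with h | h <;> rw [h] <;> norm_num

@[simp] lemma abs_val (u : ℤˣ) : |val u| = 1 := by
  rcases val_cases u with h | h <;> rw [h] <;> norm_num

lemma expect_units (F : ℤˣ → ℝ) : 𝔼 u, F u = (F 1 + F (-1)) / 2 := by
  rw [Fintype.expect_eq_sum_div_card]
  have : (Finset.univ : Finset ℤˣ) = {1, -1} := rfl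
  rw [this, Finset.sum_pair (by decide)]
  simp

variable {n : ℕ}

/-- The Walsh character of a set of coordinates. -/
noncomputable def walsh (S : Finset (Fin n)) (x : Cube n) : ℝ := ∏ i ∈ S, val (x i)

/-- The Fourier–Walsh coefficient. -/
noncomputable def fourier (h : Cube n → ℝ) (S : Finset (Fin n)) : ℝ := 𝔼 x, h x * walsh S x

lemma walsh_eq_prod (S : Finset (Fin n)) (x : Cube n) :
    walsh S x = ∏ i, if i ∈ S then val (x i) else 1 := by
  simp [walsh, Finset.prod_ite_mem]

@[simp] lemma walsh_empty (x : Cube n) : walsh ∅ x = 1 := by simp [walsh]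

@[simp] lemma walsh_singleton (i : Fin n) (x : Cube n) : walsh {i} x = val (x i) := by simp [walsh]

lemma walsh_neg (S : Finset (Fin n)) (x : Cube n) : walsh S (-x) = (-1) ^ S.card * walsh S x := by
  simp [walsh, Finset.prod_neg]

lemma expect_walsh_mul (S T : Finset (Fin n)) :
    𝔼 x, walsh S x * walsh T x = if S = T then 1 else 0 := by
  have h : ∀ x : Cube n, walsh S x * walsh T x =
      ∏ i, (if i ∈ S then val (x i) else 1) * (if i ∈ T then val (x i) else 1) := fun x => by
    rw [walsh_eq_prod, walsh_eq_prod, Finset.prod_mul_distrib]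
  simp only [h]
  rw [expect_pi_prod (fun (i : Fin n) u => (if i ∈ S then val u else 1) *
    (if i ∈ T then val u else 1))]
  split_ifs with hST
  · subst hST
    refine Finset.prod_eq_one fun i _ => ?_
    rw [expect_units]
    by_cases hi : i ∈ S <;> simp [hi]
  · have : ∃ i, ¬(i ∈ S ↔ i ∈ T) := by
      by_contra hc
      push Not at hc
      exact hST (Finset.ext hc)
    obtain ⟨i, hi⟩ := this
    refine Finset.prod_eq_zero (Finset.mem_univ i) ?_
    rw [expect_units]
    by_cases h1 : i ∈ S <;> by_cases h2 : i ∈ T <;> simp_all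

lemma sum_walsh_mul (x y : Cube n) :
    ∑ S, walsh S x * walsh S y = if x = y then (Fintype.card (Cube n) : ℝ) else 0 := by
  have h := Finset.prod_one_add (f := fun i => val (x i) * val (y i)) (Finset.univ : Finset (Fin n))
  rw [Finset.powerset_univ] at h
  simp only [walsh, ← Finset.prod_mul_distrib]
  rw [← h]
  split_ifs with hxy
  · subst hxy
    simp [one_add_one_eq_two]
  · obtain ⟨i, hi⟩ := Function.ne_iff.1 hxy
    refine Finset.prod_eq_zero (Finset.mem_univ i) ?_
    rcases Int.units_eq_one_or (x i) with h1 | h1 <;>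
      rcases Int.units_eq_one_or (y i) with h2 | h2 <;> simp_all

lemma fourier_inversion (h : Cube n → ℝ) (x : Cube n) : h x = ∑ S, fourier h S * walsh S x := by
  simp only [fourier, Finset.expect_mul]
  rw [← Finset.expect_sum_comm]
  simp only [mul_assoc, ← Finset.mul_sum, sum_walsh_mul]
  rw [Fintype.expect_eq_sum_div_card]
  simp

lemma expect_sq_of_walsh_sum (a : Finset (Fin n) → ℝ) :
    𝔼 x, (∑ S, a S * walsh S x) ^ 2 = ∑ S, a S ^ 2 := by
  simp only [sq (∑ S, _), Finset.sum_mul_sum, Finset.expect_sum_comm]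
  refine Finset.sum_congr rfl fun S _ => ?_
  have : ∀ T, 𝔼 x, a S * walsh S x * (a T * walsh T x) = a S * a T * if S = T then 1 else 0 := by
    intro T
    rw [← expect_walsh_mul, Finset.mul_expect]
    exact Finset.expect_congr rfl fun x _ => by ring
  simp only [this]
  simp [sq]

lemma parseval (h : Cube n → ℝ) : ∑ S, fourier h S ^ 2 = 𝔼 x, h x ^ 2 := by
  rw [← expect_sq_of_walsh_sum]
  exact Finset.expect_congr rfl fun x _ => by rw [← fourier_inversion]

lemma sum_fourier_sq_le_one {h : Cube n → ℝ} (hh : ∀ x, |h x| ≤ 1) : ∑ S, fourier h S ^ 2 ≤ 1 := by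
  rw [parseval]
  exact expect_le_const fun x => by rw [← sq_abs]; exact pow_le_one₀ (abs_nonneg _) (hh x)

lemma fourier_sq_le_one {h : Cube n → ℝ} (hh : ∀ x, |h x| ≤ 1) (S : Finset (Fin n)) :
    fourier h S ^ 2 ≤ 1 :=
  (Finset.single_le_sum (f := fun T => fourier h T ^ 2) (fun _ _ => sq_nonneg _)
    (Finset.mem_univ S)).trans (sum_fourier_sq_le_one hh)

lemma abs_fourier_le_one {h : Cube n → ℝ} (hh : ∀ x, |h x| ≤ 1) (S : Finset (Fin n)) :
    |fourier h S| ≤ 1 :=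
  (sq_le_one_iff_abs_le_one _).1 (fourier_sq_le_one hh S)

lemma fourier_of_odd {h : Cube n → ℝ} (hh : ∀ x, h (-x) = -h x) {S : Finset (Fin n)}
    (hS : Even S.card) : fourier h S = 0 := by
  have h1 : fourier h S = 𝔼 x, h (-x) * walsh S (-x) :=
    Fintype.expect_equiv (Equiv.neg (Cube n)) _ _ (fun x => by simp)
  have h2 : 𝔼 x, h (-x) * walsh S (-x) = -fourier h S := by
    rw [fourier, ← Finset.expect_neg_distrib]
    exact Finset.expect_congr rfl fun x _ => by rw [hh, walsh_neg, hS.neg_one_pow]; ring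
  linarith

/-! ### The dictatorship test. -/

/-- The random choices of the dictatorship test: two points, a mask and a replacement point. -/
abbrev TestSeed (n : ℕ) : Type := Cube n × Cube n × Cube n × Cube n

/-- The third point of the dictatorship test: a noisy version of the product of the first two. -/
def thirdPoint (s : TestSeed n) : Cube n := fun i =>
  if s.2.2.1 i = 1 then s.1 i * s.2.1 i else s.2.2.2 i

/-- The statistic of the dictatorship test. -/
def testValue (G : Cube n → ℝ) (s : TestSeed n) : ℝ := G s.1 * G s.2.1 * G (thirdPoint s)

/-- Each coordinate of the third point is `x i * y i` or a fresh mean-zero sign, with probability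
`1/2` each, so each element of `S` contributes a factor `1/2`. -/
lemma expect_walsh_thirdPoint (S : Finset (Fin n)) (x y : Cube n) :
    𝔼 p : Cube n × Cube n, walsh S (thirdPoint (x, y, p)) =
      (1 / 2) ^ S.card * (walsh S x * walsh S y) := by
  have h : ∀ m u : Cube n, walsh S (thirdPoint (x, y, m, u)) =
      ∏ i, if i ∈ S then val (if m i = 1 then x i * y i else u i) else 1 := fun m u => by
    rw [walsh_eq_prod]; rfl
  rw [expect_prod_type]
  simp only [h]
  have h1 : ∀ m : Cube n, 𝔼 u : Cube n,
      ∏ i, (if i ∈ S then val (if m i = 1 then x i * y i else u i) else 1) =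
      ∏ i, if i ∈ S then (if m i = 1 then val (x i) * val (y i) else 0) else 1 := by
    intro m
    rw [expect_pi_prod (fun (i : Fin n) u =>
      if i ∈ S then val (if m i = 1 then x i * y i else u) else 1)]
    refine Finset.prod_congr rfl fun i _ => ?_
    rw [expect_units]
    by_cases hi : i ∈ S <;> by_cases hm : m i = 1 <;> simp [hi, hm]
  simp only [h1]
  rw [expect_pi_prod (fun (i : Fin n) v =>
      if i ∈ S then (if v = 1 then val (x i) * val (y i) else 0) else 1)]
  simp only [expect_units]
  rw [walsh, walsh, ← Finset.prod_mul_distrib, ← Finset.prod_const, ← Finset.prod_mul_distrib,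
    ← Finset.prod_subset (Finset.subset_univ S)]
  · refine Finset.prod_congr rfl fun i hi => ?_
    have : (-1 : ℤˣ) ≠ 1 := by decide
    simp [hi, this]; ring
  · intro i _ hi
    simp [hi]

lemma expect_testValue (G : Cube n → ℝ) :
    𝔼 s, testValue G s = ∑ S, (1 / 2) ^ S.card * fourier G S ^ 3 := by
  have h1 : ∀ x y : Cube n, 𝔼 p : Cube n × Cube n, G x * G y * G (thirdPoint (x, y, p)) =
      ∑ S, ((1 / 2) ^ S.card * fourier G S) * (G x * walsh S x) * (G y * walsh S y) := by
    intro x y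
    have : ∀ p : Cube n × Cube n, G (thirdPoint (x, y, p)) =
      ∑ S, fourier G S * walsh S (thirdPoint (x, y, p)) := fun p => fourier_inversion _ _
    simp only [this, Finset.mul_sum, Finset.expect_sum_comm]
    refine Finset.sum_congr rfl fun S _ => ?_
    simp only [← mul_assoc (G x * G y), ← Finset.mul_expect, expect_walsh_thirdPoint]
    ring
  have h2 : 𝔼 s, testValue G s = 𝔼 x : Cube n, 𝔼 y : Cube n,
      ∑ S, ((1 / 2) ^ S.card * fourier G S) * (G x * walsh S x) * (G y * walsh S y) := by
    rw [expect_prod_type]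
    refine Finset.expect_congr rfl fun x _ => ?_
    rw [expect_prod_type]
    exact Finset.expect_congr rfl fun y _ => h1 x y
  rw [h2]
  simp only [Finset.expect_sum_comm]
  refine Finset.sum_congr rfl fun S _ => ?_
  simp only [← Finset.mul_expect, ← Finset.expect_mul]
  change (1 / 2) ^ S.card * fourier G S * fourier G S * fourier G S = _
  ring

/-- Soundness of the dictatorship test. -/
lemma exists_fourier_singleton_of_expect_testValue {G : Cube n → ℝ} (hG : ∀ x, |G x| ≤ 1)
    (hodd : ∀ x, G (-x) = -G x) {η : ℝ} (hη : η < 3 / 8)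
    (h : 1 / 2 - η ≤ |𝔼 s, testValue G s|) : ∃ i, 1 - 2 * η ≤ |fourier G {i}| := by
  by_contra hc
  push Not at hc
  rw [expect_testValue] at h
  -- Oddness kills the even levels. Singletons are bounded by the negated claim, and the remaining
  -- levels have weight at most `1/8`, which is below `1/2 - η` because `η < 3/8`.
  have hterm : ∀ S : Finset (Fin n), fourier G S ≠ 0 →
      (1 / 2) ^ S.card * |fourier G S| < 1 / 2 - η := by
    intro S hS
    have hodd' : Odd S.card := by
      rw [← Nat.not_even_iff_odd]
      exact fun he => hS (fourier_of_odd hodd he)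
    by_cases h1 : S.card = 1
    · obtain ⟨i, rfl⟩ := Finset.card_eq_one.1 h1
      have := hc i
      rw [h1]; linarith
    · have h3 : 3 ≤ S.card := by obtain ⟨r, hr⟩ := hodd'; omega
      have : ((1 : ℝ) / 2) ^ S.card ≤ (1 / 2) ^ 3 :=
        pow_le_pow_of_le_one (by norm_num) (by norm_num) h3
      have h4 := abs_fourier_le_one hG S
      have h5 : ((1 : ℝ) / 2) ^ S.card * |fourier G S| ≤ (1 / 2) ^ 3 * 1 := by gcongr
      linarith
  have habs : |∑ S, (1 / 2) ^ S.card * fourier G S ^ 3| ≤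
      ∑ S, ((1 / 2) ^ S.card * |fourier G S|) * fourier G S ^ 2 := by
    refine (Finset.abs_sum_le_sum_abs _ _).trans (le_of_eq (Finset.sum_congr rfl fun S _ => ?_))
    rw [abs_mul, abs_of_pos (by positivity : (0 : ℝ) < (1 / 2) ^ S.card), abs_pow, ← sq_abs]
    ring
  by_cases hz : ∀ S, fourier G S = 0
  · simp [hz] at h
    linarith
  · push Not at hz
    obtain ⟨S₀, hS₀⟩ := hz
    have h1 : ∑ S, ((1 / 2) ^ S.card * |fourier G S|) * fourier G S ^ 2 <
        ∑ S, (1 / 2 - η) * fourier G S ^ 2 := by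
      refine Finset.sum_lt_sum (fun S _ => ?_) ⟨S₀, Finset.mem_univ _, ?_⟩
      · by_cases hS : fourier G S = 0
        · simp [hS]
        · exact mul_le_mul_of_nonneg_right (hterm S hS).le (sq_nonneg _)
      · exact mul_lt_mul_of_pos_right (hterm S₀ hS₀) (by positivity)
    rw [← Finset.mul_sum] at h1
    have h2 := sum_fourier_sq_le_one hG
    nlinarith

/-- Completeness of the dictatorship test. -/
lemma le_abs_expect_testValue {G : Cube n → ℝ} (hG : ∀ x, |G x| ≤ 1) {i : Fin n} {η : ℝ}
    (h0 : 0 ≤ η) (h1 : η ≤ 1) (h : 1 - η ≤ |fourier G {i}|) :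
    1 / 2 - 4 * η ≤ |𝔼 s, testValue G s| := by
  rw [expect_testValue]
  have hs := sum_fourier_sq_le_one hG
  rw [← Finset.add_sum_erase _ _ (Finset.mem_univ {i})] at hs ⊢
  set a := fourier G {i}
  have ha : a ^ 2 = |a| ^ 2 := (sq_abs a).symm
  have hrest : |∑ S ∈ Finset.univ.erase {i}, (1 / 2) ^ S.card * fourier G S ^ 3| ≤
      ∑ S ∈ Finset.univ.erase {i}, fourier G S ^ 2 := by
    refine (Finset.abs_sum_le_sum_abs _ _).trans (Finset.sum_le_sum fun S _ => ?_)
    have hle1 := abs_fourier_le_one hG S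
    rw [abs_mul, abs_of_pos (by positivity : (0 : ℝ) < (1 / 2) ^ S.card), abs_pow,
      ← sq_abs (fourier G S)]
    have h2 : ((1 : ℝ) / 2) ^ S.card ≤ 1 := pow_le_one₀ (by norm_num) (by norm_num)
    have h3 : |fourier G S| ^ 3 ≤ |fourier G S| ^ 2 :=
      pow_le_pow_of_le_one (abs_nonneg _) hle1 (by norm_num)
    nlinarith [pow_nonneg (abs_nonneg (fourier G S)) 3]
  -- The main term loses at most `3η/2`; by Parseval all other coefficients together contribute at
  -- most `1 - (1 - η) ^ 2 ≤ 2η`.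
  have hsq : (1 - η) ^ 2 ≤ |a| ^ 2 := by gcongr
  have hcub : (1 - η) ^ 3 ≤ |a| ^ 3 := by gcongr
  have hmain : |(1 / 2) ^ ({i} : Finset (Fin n)).card * a ^ 3| = 1 / 2 * |a| ^ 3 := by
    rw [abs_mul, abs_pow, Finset.card_singleton]; norm_num
  have htri := abs_sub_abs_le_abs_add ((1 / 2) ^ ({i} : Finset (Fin n)).card * a ^ 3)
    (∑ S ∈ Finset.univ.erase {i}, (1 / 2) ^ S.card * fourier G S ^ 3)
  rw [hmain] at htri
  have hb : 1 - 3 * η ≤ (1 - η) ^ 3 := by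
    nlinarith [mul_nonneg h0 h0, mul_nonneg (mul_nonneg h0 h0) (sub_nonneg.2 h1)]
  nlinarith [sq_nonneg η]

end Fourier

/-! ### Approximate coordinate oracles. -/

section Gadget

variable {n : ℕ}

lemma expect_walsh_piecewise (B T : Finset (Fin n)) (x : Cube n) :
    𝔼 w, walsh T (B.piecewise x w) = if T ⊆ B then walsh T x else 0 := by
  have h : ∀ w : Cube n, walsh T (B.piecewise x w) =
      ∏ i, if i ∈ T then val (if i ∈ B then x i else w i) else 1 := fun w => by
    rw [walsh_eq_prod]; rfl
  simp only [h]
  rw [expect_pi_prod (fun (i : Fin n) u => if i ∈ T then val (if i ∈ B then x i else u) else 1)]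
  simp only [expect_units]
  split_ifs with hTB
  · rw [walsh_eq_prod]
    refine Finset.prod_congr rfl fun i _ => ?_
    by_cases hi : i ∈ T
    · simp [hi, hTB hi]
    · simp [hi]
  · obtain ⟨i, hi, hiB⟩ := Finset.not_subset.1 hTB
    exact Finset.prod_eq_zero (Finset.mem_univ i) (by simp [hi, hiB])

lemma expect_piecewise (h : Cube n → ℝ) (B : Finset (Fin n)) (x : Cube n) :
    𝔼 w, h (B.piecewise x w) = ∑ T, (if T ⊆ B then fourier h T else 0) * walsh T x := by
  have : ∀ w, h (B.piecewise x w) = ∑ T, fourier h T * walsh T (B.piecewise x w) :=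
    fun w => fourier_inversion _ _
  simp only [this, Finset.expect_sum_comm, ← Finset.mul_expect, expect_walsh_piecewise]
  exact Finset.sum_congr rfl fun T _ => by split_ifs <;> simp

/-- The mean square distance of `H` from the affine function with the linear part `β x_i`. -/
noncomputable def affineError (H : Cube n → ℝ) (a β : ℝ) (i : Fin n) : ℝ :=
  𝔼 x, (H x - (a + β * val (x i))) ^ 2

lemma affineError_nonneg (H : Cube n → ℝ) (a β : ℝ) (i : Fin n) : 0 ≤ affineError H a β i :=
  Finset.expect_nonneg fun _ _ => sq_nonneg _

/-- The empirical version of the average of `h` over the coordinates outside `B`. -/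
noncomputable def blockMean {M : ℕ} (h : Cube n → ℝ) (B : Finset (Fin n)) (w : Fin M → Cube n)
    (x : Cube n) : ℝ := emp (fun v => h (B.piecewise x v)) w

/-- Exact averaging outside `B` leaves the characters inside `B`. Sampling adds variance `1 / M`,
and by Parseval the bias is the weight of the surviving characters other than `∅` and `{i}`. -/
lemma expect_affineError_le {M : ℕ} (hM : 0 < M) {h : Cube n → ℝ} (hh : ∀ x, |h x| ≤ 1)
    {B : Finset (Fin n)} {i : Fin n} (hi : i ∈ B) :
    𝔼 w : Fin M → Cube n, affineError (blockMean h B w) (fourier h ∅) (fourier h {i}) i ≤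
      1 / M + ∑ T, (if T ⊆ B ∧ T ≠ ∅ ∧ T ≠ {i} then fourier h T else 0) ^ 2 := by
  simp only [affineError]
  rw [Finset.expect_comm]
  rw [← expect_sq_of_walsh_sum]
  have h1 : ∀ x : Cube n, 𝔼 w : Fin M → Cube n,
      (blockMean h B w x - (fourier h ∅ + fourier h {i} * val (x i))) ^ 2 ≤ 1 / M +
      (∑ T, (if T ⊆ B ∧ T ≠ ∅ ∧ T ≠ {i} then fourier h T else 0) * walsh T x) ^ 2 := by
    intro x
    refine (expect_emp_sub_sq hM (F := fun v => h (B.piecewise x v)) (fun v => hh _) _).trans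
      (le_of_eq ?_)
    congr 2
    rw [expect_piecewise]
    have h2 : ∀ T : Finset (Fin n), (if T ⊆ B then fourier h T else 0) * walsh T x =
        (if T ⊆ B ∧ T ≠ ∅ ∧ T ≠ {i} then fourier h T else 0) * walsh T x +
        ((if T = ∅ then fourier h ∅ else 0) +
          if T = {i} then fourier h {i} * val (x i) else 0) := by
      intro T
      by_cases h3 : T = ∅
      · subst h3
        simp
      · by_cases h4 : T = {i}
        · subst h4
          simp [hi]
        · simp [h3, h4]
    simp only [h2]
    rw [Finset.sum_add_distrib, Finset.sum_add_distrib, Finset.sum_ite_eq', Finset.sum_ite_eq']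
    simp
  refine (expect_mono h1).trans (le_of_eq ?_)
  rw [Finset.expect_add_distrib, Fintype.expect_const]

/-- The coordinates of colour `0`. -/
def zeros {r : ℕ} (c : Fin n → Fin (r + 1)) : Finset (Fin n) := Finset.univ.filter fun i => c i = 0

@[simp] lemma mem_zeros {r : ℕ} {c : Fin n → Fin (r + 1)} {i : Fin n} : i ∈ zeros c ↔ c i = 0 := by
  simp [zeros]

lemma expect_ind_eq_zero (r : ℕ) : 𝔼 a : Fin (r + 1), ind (a = 0) = 1 / ((r : ℝ) + 1) := by
  rw [Fintype.expect_eq_sum_div_card, Fintype.sum_eq_single 0 fun a ha => ind_of_not ha, ind_of rfl]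
  simp

lemma pr_color (r : ℕ) (i : Fin n) :
    𝔼 c : Fin n → Fin (r + 1), ind (c i = 0) = 1 / ((r : ℝ) + 1) := by
  rw [← expect_ind_eq_zero]
  exact expect_pi_apply (fun a : Fin (r + 1) => ind (a = 0)) i

lemma pr_color_two (r : ℕ) {i j : Fin n} (hij : i ≠ j) :
    𝔼 c : Fin n → Fin (r + 1), ind (c i = 0) * ind (c j = 0) = (1 / ((r : ℝ) + 1)) ^ 2 := by
  rw [expect_pi_apply_mul (fun a : Fin (r + 1) => ind (a = 0)) (fun a => ind (a = 0)) hij,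
    expect_ind_eq_zero, sq]

/-- Bonferroni: from the probability of `c i = 0`, subtract those of the pairs `c i = c s = 0`. -/
lemma le_pr_isolated (r : ℕ) {i : Fin n} {S : Finset (Fin n)} (hi : i ∉ S) :
    1 / ((r : ℝ) + 1) - S.card * (1 / ((r : ℝ) + 1)) ^ 2 ≤
      𝔼 c : Fin n → Fin (r + 1), ind (c i = 0 ∧ ∀ s ∈ S, c s ≠ 0) := by
  have h : ∀ c : Fin n → Fin (r + 1), ind (c i = 0) - ∑ s ∈ S, ind (c i = 0) * ind (c s = 0) ≤
      ind (c i = 0 ∧ ∀ s ∈ S, c s ≠ 0) := by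
    intro c
    by_cases hci : c i = 0
    · by_cases hS : ∀ s ∈ S, c s ≠ 0
      · rw [ind_of (p := _ ∧ _) ⟨hci, hS⟩, ind_of hci]
        have : 0 ≤ ∑ s ∈ S, 1 * ind (c s = 0) :=
          Finset.sum_nonneg fun s _ => by rw [one_mul]; exact ind_nonneg _
        linarith
      · rw [ind_of_not (p := _ ∧ _) (fun h => hS h.2), ind_of hci]
        push Not at hS
        obtain ⟨s, hs, hcs⟩ := hS
        have := Finset.single_le_sum (f := fun s => 1 * ind (c s = 0))
          (fun s _ => by simpa using ind_nonneg _) hs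
        simp only [ind_of hcs] at this
        linarith
    · rw [ind_of_not hci, ind_of_not (p := _ ∧ _) (fun h => hci h.1)]; simp
  refine le_trans (le_of_eq ?_) (expect_mono h)
  rw [Finset.expect_sub_distrib, pr_color, Finset.expect_sum_comm,
    Finset.sum_congr rfl fun s hs => pr_color_two r (ne_of_mem_of_not_mem hs hi).symm,
    Finset.sum_const,
    nsmul_eq_mul]

/-- Any `T` other than `∅` and `{i}` contains some `j ≠ i`, so its survival together with `c i = 0`
forces two independent colours to vanish. Parseval sums the weights. -/
lemma expect_leakage_le (m : ℕ) {h : Cube n → ℝ} (hh : ∀ x, |h x| ≤ 1) (i : Fin n) :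
    𝔼 c : Fin n → Fin (m + 1), ind (c i = 0) *
      ∑ T, (if T ⊆ zeros c ∧ T ≠ ∅ ∧ T ≠ {i} then fourier h T else 0) ^ 2 ≤
      (1 / ((m : ℝ) + 1)) ^ 2 := by
  simp only [Finset.mul_sum, Finset.expect_sum_comm]
  have h1 : ∀ T, 𝔼 c : Fin n → Fin (m + 1), ind (c i = 0) *
      (if T ⊆ zeros c ∧ T ≠ ∅ ∧ T ≠ {i} then fourier h T else 0) ^ 2 ≤
      (1 / ((m : ℝ) + 1)) ^ 2 * fourier h T ^ 2 := by
    intro T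
    by_cases hT : T ≠ ∅ ∧ T ≠ {i}
    · have : ∃ j ∈ T, i ≠ j := by
        by_contra hc
        push Not at hc
        obtain ⟨j, hj⟩ := Finset.nonempty_iff_ne_empty.2 hT.1
        exact hT.2 (Finset.eq_singleton_iff_unique_mem.2
          ⟨by rw [hc j hj]; exact hj, fun x hx => (hc x hx).symm⟩)
      obtain ⟨j, hj, hij⟩ := this
      rw [← pr_color_two m hij, Finset.expect_mul]
      refine expect_mono fun c => ?_
      rw [mul_assoc]
      refine mul_le_mul_of_nonneg_left ?_ (ind_nonneg _)
      split_ifs with hc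
      · rw [ind_of (mem_zeros.1 (hc.1 hj)), one_mul]
      · rw [zero_pow two_ne_zero]
        exact mul_nonneg (ind_nonneg _) (sq_nonneg _)
    · have : ∀ c : Fin n → Fin (m + 1), ¬(T ⊆ zeros c ∧ T ≠ ∅ ∧ T ≠ {i}) := fun c h => hT h.2
      simp only [this, if_false]
      simp
      positivity
  refine (Finset.sum_le_sum fun T _ => h1 T).trans ?_
  rw [← Finset.mul_sum]
  exact mul_le_of_le_one_right (by positivity) (sum_fourier_sq_le_one hh)

/-- The integrand is the coefficient squared minus a penalty for the affine error. Its mean is a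
lower bound for a success probability by `ind_mul_le_ind_nearDictator`. -/
lemma le_expect_block {m M : ℕ} (hM : 0 < M) {h : Cube n → ℝ} (hh : ∀ x, |h x| ≤ 1) (i : Fin n)
    {δ : ℝ} (hδ : 0 < δ) :
    1 / ((m : ℝ) + 1) * (fourier h {i} ^ 2 - 1 / δ * (1 / M + 1 / ((m : ℝ) + 1))) ≤
    𝔼 p : (Fin n → Fin (m + 1)) × (Fin M → Cube n), ind (p.1 i = 0) * (fourier h {i} ^ 2 -
      affineError (blockMean h (zeros p.1) p.2) (fourier h ∅) (fourier h {i}) i / δ) := by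
  rw [expect_prod_type]
  set β := fourier h {i}
  have h1 : ∀ c : Fin n → Fin (m + 1), ind (c i = 0) * (β ^ 2 - 1 / δ * (1 / M)) - 1 / δ *
      (ind (c i = 0) *
        ∑ T, (if T ⊆ zeros c ∧ T ≠ ∅ ∧ T ≠ {i} then fourier h T else 0) ^ 2) ≤
      𝔼 w : Fin M → Cube n, ind (c i = 0) * (β ^ 2 -
        affineError (blockMean h (zeros c) w) (fourier h ∅) β i / δ) := by
    intro c
    rw [← Finset.mul_expect, Finset.expect_sub_distrib, Fintype.expect_const, ← Finset.expect_div]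
    by_cases hc : c i = 0
    · rw [ind_of hc]
      have h2 := expect_affineError_le hM hh (mem_zeros.2 hc)
      have h3 := div_le_div_of_nonneg_right h2 hδ.le
      rw [add_div] at h3
      have h4 : ∀ y : ℝ, 1 / δ * y = y / δ := fun y => by ring
      rw [one_mul, one_mul, one_mul, h4, h4]
      linarith
    · rw [ind_of_not hc]; simp
  refine le_trans ?_ (expect_mono h1)
  rw [Finset.expect_sub_distrib, ← Finset.expect_mul, ← Finset.mul_expect, pr_color]
  have h2 := mul_le_mul_of_nonneg_left (expect_leakage_le m hh i) (one_div_pos.2 hδ).le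
  nlinarith

lemma expect_comp_neg (F : Cube n → ℝ) : 𝔼 x, F (-x) = 𝔼 x, F x :=
  Fintype.expect_equiv (Equiv.neg (Cube n)) _ _ (fun x => by simp)

/-- Rounds a real function to the sign of its odd part. -/
noncomputable def roundOdd (H : Cube n → ℝ) (x : Cube n) : ℤˣ := if H (-x) ≤ H x then 1 else -1

/-- Passing to the odd part removes `a`: `H x - H (-x)` is `2 β x_i` up to the errors at `x` and
`-x`, so it has the right sign unless one of them reaches `|β|`. Chebyshev bounds each case by `δ`.
-/
lemma pr_roundOdd_ne_le (H : Cube n → ℝ) {a β δ : ℝ} (i : Fin n) (hβ : β ≠ 0)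
    (h : affineError H a β i ≤ δ * β ^ 2) :
    ∃ σ : ℤˣ, pr (fun x => roundOdd H x ≠ σ * x i) ≤ 2 * δ := by
  have hβ' : 0 < |β| := abs_pos.2 hβ
  set err : Cube n → ℝ := fun x => H x - (a + β * val (x i)) with herr
  refine ⟨if 0 < β then 1 else -1, ?_⟩
  have h1 : pr (fun x => |β| ≤ |err x|) ≤ δ := by
    refine (pr_le_of_sq hβ' h).trans (le_of_eq ?_)
    rw [sq_abs]; field_simp
  have h2 : pr (fun x => |β| ≤ |err (-x)|) ≤ δ := by
    refine le_trans (le_of_eq ?_) h1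
    exact expect_comp_neg fun x => ind (|β| ≤ |err x|)
  rw [two_mul]
  refine (pr_mono ?_).trans ((pr_or_le _ _).trans (add_le_add h1 h2))
  intro x hx
  by_contra hc
  push Not at hc
  obtain ⟨hc1, hc2⟩ := hc
  have e1 : H x = err x + a + β * val (x i) := by simp only [herr]; ring
  have e2 : H (-x) = err (-x) + a - β * val (x i) := by
    simp only [herr, Pi.neg_apply, val_neg]; ring
  apply hx
  obtain ⟨l1, u1⟩ := abs_lt.1 hc1
  obtain ⟨l2, u2⟩ := abs_lt.1 hc2
  unfold roundOdd
  rcases lt_or_gt_of_ne hβ with hneg | hpos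
  · rw [abs_of_neg hneg] at l1 u1 l2 u2
    rw [if_neg (not_lt.2 hneg.le)]
    rcases Int.units_eq_one_or (x i) with hxi | hxi <;> rw [hxi] at e1 e2 ⊢
    · rw [if_neg]; · simp
      simp only [val_one] at e1 e2
      linarith
    · rw [if_pos]; · simp
      simp only [val_neg, val_one] at e1 e2
      linarith
  · rw [abs_of_pos hpos] at l1 u1 l2 u2
    rw [if_pos hpos]
    rcases Int.units_eq_one_or (x i) with hxi | hxi <;> rw [hxi] at e1 e2 ⊢
    · rw [if_pos]; · simp
      simp only [val_one] at e1 e2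
      linarith
    · rw [if_neg]; · simp
      simp only [val_neg, val_one] at e1 e2
      linarith

/-- Swapping the coordinates outside `J` between two independent uniform points is a bijection on
pairs. -/
lemma expect_piecewise_pair (J : Finset (Fin n)) (F : Cube n → ℝ) :
    𝔼 z, 𝔼 x, F (J.piecewise x z) = 𝔼 x, F x := by
  have h := expect_prod_type (fun p : Cube n × Cube n => F (J.piecewise p.2 p.1))
  rw [← h]
  let e : Cube n × Cube n ≃ Cube n × Cube n :=
    { toFun := fun p => (J.piecewise p.2 p.1, J.piecewise p.1 p.2)
      invFun := fun p => (J.piecewise p.2 p.1, J.piecewise p.1 p.2)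
      left_inv := fun p => by
        ext i <;> by_cases hi : i ∈ J <;> simp [hi]
      right_inv := fun p => by
        ext i <;> by_cases hi : i ∈ J <;> simp [hi] }
  rw [Fintype.expect_equiv e (fun p : Cube n × Cube n => F (J.piecewise p.2 p.1))
    (fun p => F p.1) (fun p => rfl), expect_prod_type]
  simp only [Fintype.expect_const]

/-- The value of `f` after the coordinates outside `J` have been fixed to those of `z`. -/
def restrict (f : BoolFun n) (J : Finset (Fin n)) (z x : Cube n) : ℝ := val (f (J.piecewise x z))

/-- `f` has correlation at least `γ` with the product of the coordinate `i` and some function of the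
coordinates in `S` with values in `[-1, 1]`. -/
def Relevant (f : BoolFun n) (γ : ℝ) (S : Finset (Fin n)) (i : Fin n) : Prop :=
  ∃ u : Cube n → ℝ, (∀ x, |u x| ≤ 1) ∧ (∀ x y : Cube n, (∀ s ∈ S, x s = y s) → u x = u y) ∧
    γ ≤ 𝔼 x, val (f x) * val (x i) * u x

/-- Once the coordinates in `S` are fixed by `z`, the factor `u` is constant, so the correlation is
the mean over `z` of `ĥ({i}) * u z`; a weighted AM–GM inequality converts this first moment into a
second moment. -/
lemma Relevant.le_expect_fourier_sq {f : BoolFun n} {γ : ℝ} (hγ : 0 < γ) {S : Finset (Fin n)}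
    {i : Fin n} (h : Relevant f γ S i) {J : Finset (Fin n)} (hi : i ∈ J) (hS : ∀ s ∈ S, s ∉ J) :
    γ ^ 2 ≤ 𝔼 z, fourier (restrict f J z) {i} ^ 2 := by
  obtain ⟨u, hu1, huS, hu⟩ := h
  rw [← expect_piecewise_pair J] at hu
  have h1 : ∀ z, 𝔼 x, val (f (J.piecewise x z)) * val (J.piecewise x z i) * u (J.piecewise x z) ≤
      (fourier (restrict f J z) {i} ^ 2 / γ + γ) / 2 := by
    intro z
    have h2 : 𝔼 x, val (f (J.piecewise x z)) * val (J.piecewise x z i) * u (J.piecewise x z) =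
        fourier (restrict f J z) {i} * u z := by
      rw [fourier, Finset.expect_mul]
      refine Finset.expect_congr rfl fun x _ => ?_
      rw [walsh_singleton, restrict, Finset.piecewise_eq_of_mem _ _ _ hi,
        huS (J.piecewise x z) z fun s hs => Finset.piecewise_eq_of_notMem _ _ _ (hS s hs)]
    rw [h2]
    set b := fourier (restrict f J z) {i}
    have h3 : u z ^ 2 ≤ 1 := by rw [← sq_abs]; exact pow_le_one₀ (abs_nonneg _) (hu1 z)
    have h4 : b ^ 2 / γ + γ - 2 * (b * u z) = ((b - γ * u z) ^ 2 + γ ^ 2 * (1 - u z ^ 2)) / γ := by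
      field_simp; ring
    have h5 : 0 ≤ ((b - γ * u z) ^ 2 + γ ^ 2 * (1 - u z ^ 2)) / γ := by
      have := sub_nonneg.2 h3
      positivity
    linarith
  have h2 := hu.trans (expect_mono h1)
  rw [← Finset.expect_div, Finset.expect_add_distrib, ← Finset.expect_div, Fintype.expect_const]
    at h2
  have h3 : γ ≤ (𝔼 z, fourier (restrict f J z) {i} ^ 2) / γ := by linarith
  rw [le_div_iff₀ hγ] at h3
  linarith

/-- The random choices behind an approximate coordinate oracle: the coordinates of nonzero first
colour are fixed, those of nonzero second colour are averaged over a sample. -/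
abbrev GadgetSeed (n r m M : ℕ) : Type :=
  ((Fin n → Fin (r + 1)) × Cube n) × (Fin n → Fin (m + 1)) × (Fin M → Cube n)

variable {r m M : ℕ}

/-- The averaged answers from which the approximate coordinate oracle is computed. -/
noncomputable def response (f : BoolFun n) (s : GadgetSeed n r m M) : Cube n → ℝ :=
  blockMean (restrict f (zeros s.1.1) s.1.2) (zeros s.2.1) s.2.2

/-- The approximate coordinate oracle. -/
noncomputable def gadget (f : BoolFun n) (s : GadgetSeed n r m M) : BoolFun n :=
  roundOdd (response f s)

/-- `g` agrees with the coordinate `i` or its negation up to a fraction `κ` of the points. -/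
def NearDictator (g : BoolFun n) (i : Fin n) (κ : ℝ) : Prop :=
  ∃ σ : ℤˣ, pr (fun x => g x ≠ σ * x i) ≤ κ

/-- When `A ≤ δ β ^ 2` with `β ≠ 0`, rounding succeeds and the left side is at most `1`; otherwise
the left side is nonpositive. This avoids choosing a cutoff for `|β|`. -/
lemma ind_mul_le_ind_nearDictator (f : BoolFun n) {δ : ℝ} (hδ : 0 < δ) (i : Fin n) (p : Prop)
    (s : GadgetSeed n r m M) :
    ind p * (ind (s.2.1 i = 0) *
        (fourier (restrict f (zeros s.1.1) s.1.2) {i} ^ 2 - affineError (response f s)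
          (fourier (restrict f (zeros s.1.1) s.1.2) ∅)
          (fourier (restrict f (zeros s.1.1) s.1.2) {i}) i / δ)) ≤
      ind (NearDictator (gadget f s) i (2 * δ)) := by
  set β := fourier (restrict f (zeros s.1.1) s.1.2) {i} with hβ
  set a := fourier (restrict f (zeros s.1.1) s.1.2) ∅
  set A := affineError (response f s) a β i with hA
  have hA0 : 0 ≤ A / δ := div_nonneg (affineError_nonneg _ _ _ _) hδ.le
  have i1 := ind_nonneg p
  have i2 := ind_nonneg (s.2.1 i = 0)
  by_cases hgood : A ≤ δ * β ^ 2 ∧ β ≠ 0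
  · rw [ind_of (p := NearDictator (gadget f s) i (2 * δ))
      (pr_roundOdd_ne_le _ i hgood.2 hgood.1)]
    have hβ1 : β ^ 2 ≤ 1 := fourier_sq_le_one (fun x => (abs_val _).le) _
    have hβ2 : 0 ≤ β ^ 2 - A / δ := by
      rw [sub_nonneg, div_le_iff₀ hδ]; linarith [hgood.1]
    exact mul_le_one₀ (ind_le_one _) (mul_nonneg i2 hβ2)
      (mul_le_one₀ (ind_le_one _) hβ2 (by linarith))
  · refine le_trans ?_ (ind_nonneg _)
    have hneg : β ^ 2 - A / δ ≤ 0 := by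
      by_cases hb : β = 0
      · rw [hb]; simpa using hA0
      · have : δ * β ^ 2 < A := by
          by_contra hc
          exact hgood ⟨not_lt.1 hc, hb⟩
        rw [sub_nonpos, le_div_iff₀ hδ]; linarith
    exact mul_nonpos_of_nonneg_of_nonpos i1 (mul_nonpos_of_nonneg_of_nonpos i2 hneg)

/-- Three factors: `J` contains `i` and avoids `S`, the block contains `i`, and the squared
coefficient, of mean at least `γ ^ 2`, loses at most half of that to the affine error. -/
lemma le_pr_nearDictator {f : BoolFun n} {γ δ : ℝ} (hγ : 0 < γ) (hδ : 0 < δ) (hM : 0 < M)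
    {S : Finset (Fin n)} {i : Fin n} (hi : i ∉ S) (h : Relevant f γ S i)
    (hrS : 2 * S.card ≤ r + 1) (hm : 1 / δ * (1 / M + 1 / ((m : ℝ) + 1)) ≤ γ ^ 2 / 2) :
    1 / ((r : ℝ) + 1) / 2 * (1 / ((m : ℝ) + 1) * (γ ^ 2 / 2)) ≤
      pr (fun s : GadgetSeed n r m M => NearDictator (gadget f s) i (2 * δ)) := by
  have hres : ∀ J z (x : Cube n), |restrict f J z x| ≤ 1 := fun J z x => (abs_val _).le
  refine le_trans ?_ (expect_mono fun s =>
    ind_mul_le_ind_nearDictator f hδ i (s.1.1 i = 0 ∧ ∀ t ∈ S, s.1.1 t ≠ 0) s)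
  rw [expect_prod_type]
  have h1 : ∀ q : (Fin n → Fin (r + 1)) × Cube n,
      ind (q.1 i = 0 ∧ ∀ t ∈ S, q.1 t ≠ 0) * (1 / ((m : ℝ) + 1) *
        (fourier (restrict f (zeros q.1) q.2) {i} ^ 2 - γ ^ 2 / 2)) ≤
      𝔼 p : (Fin n → Fin (m + 1)) × (Fin M → Cube n),
        ind (q.1 i = 0 ∧ ∀ t ∈ S, q.1 t ≠ 0) * (ind (p.1 i = 0) *
        (fourier (restrict f (zeros q.1) q.2) {i} ^ 2 - affineError (response f (q, p))
          (fourier (restrict f (zeros q.1) q.2) ∅)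
          (fourier (restrict f (zeros q.1) q.2) {i}) i / δ)) := by
    intro q
    rw [← Finset.mul_expect]
    refine mul_le_mul_of_nonneg_left ?_ (ind_nonneg _)
    refine le_trans ?_ (le_expect_block hM (hres (zeros q.1) q.2) i hδ)
    gcongr
  refine le_trans ?_ (expect_mono h1)
  rw [expect_prod_type]
  simp only [← Finset.mul_expect, Finset.expect_sub_distrib, Fintype.expect_const]
  have h2 : ∀ c : Fin n → Fin (r + 1),
      ind (c i = 0 ∧ ∀ t ∈ S, c t ≠ 0) * (1 / ((m : ℝ) + 1) * (γ ^ 2 / 2)) ≤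
      ind (c i = 0 ∧ ∀ t ∈ S, c t ≠ 0) * (1 / ((m : ℝ) + 1) *
        (𝔼 z, fourier (restrict f (zeros c) z) {i} ^ 2 - γ ^ 2 / 2)) := by
    intro c
    by_cases hc : c i = 0 ∧ ∀ t ∈ S, c t ≠ 0
    · rw [ind_of hc, one_mul, one_mul]
      have := h.le_expect_fourier_sq hγ (mem_zeros.2 hc.1)
        (fun s hs hs0 => hc.2 s hs (mem_zeros.1 hs0))
      refine mul_le_mul_of_nonneg_left (by linarith) (by positivity)
    · rw [ind_of_not hc]; simp
  refine le_trans ?_ (expect_mono h2)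
  rw [← Finset.expect_mul]
  refine mul_le_mul_of_nonneg_right (le_trans ?_ (le_pr_isolated r hi)) (by positivity)
  have h3 : 2 * (S.card : ℝ) ≤ (r : ℝ) + 1 := by exact_mod_cast hrS
  have hr : (0 : ℝ) < (r : ℝ) + 1 := by positivity
  have h4 : (S.card : ℝ) * (1 / ((r : ℝ) + 1)) ≤ 1 / 2 := by
    rw [mul_one_div, div_le_iff₀ hr]; linarith
  have h5 : 0 < 1 / ((r : ℝ) + 1) := by positivity
  nlinarith

end Gadget

/-! ### Relevant coordinates, composites of oracles, and the acceptance criterion. -/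

section Hypotheses

variable {n : ℕ}

lemma expect_val_mul_val (f g : BoolFun n) :
    𝔼 x, val (f x) * val (g x) = 1 - 2 * pr (fun x => f x ≠ g x) := by
  have h : ∀ x, val (f x) * val (g x) = 1 - 2 * ind (f x ≠ g x) := by
    intro x
    by_cases hx : f x = g x
    · rw [ind_of_not (not_not.2 hx), hx, val_mul_self]; norm_num
    · rw [ind_of hx]
      rcases Int.units_eq_one_or (f x) with h1 | h1 <;>
        rcases Int.units_eq_one_or (g x) with h2 | h2 <;> simp_all <;> norm_num
  simp only [h, Finset.expect_sub_distrib, Fintype.expect_const, ← Finset.mul_expect, pr]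

lemma pr_eq_card_div {Ω : Type*} [Fintype Ω] (p : Ω → Prop) [DecidablePred p] :
    pr p = ((Finset.univ.filter p).card : ℝ) / Fintype.card Ω := by
  rw [pr, Fintype.expect_eq_sum_div_card, ← Finset.sum_boole]
  congr 1
  refine Finset.sum_congr rfl fun ω _ => ?_
  by_cases h : p ω <;> simp [ind, h]

lemma dist_eq_pr (f g : BoolFun n) : dist f g = pr (fun x => f x ≠ g x) := by
  rw [pr_eq_card_div, dist]

lemma expect_mul_val_le_add (f g h : BoolFun n) :
    𝔼 x, val (f x) * val (g x) ≤ 𝔼 x, val (f x) * val (h x) + 2 * pr (fun x => g x ≠ h x) := by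
  rw [expect_val_mul_val, expect_val_mul_val]
  have : pr (fun x => f x ≠ h x) ≤ pr (fun x => f x ≠ g x) + pr (fun x => g x ≠ h x) :=
    (pr_mono fun x hx => by
      by_contra hc
      push Not at hc
      exact hx (hc.1.trans hc.2)).trans (pr_or_le _ _)
  linarith

lemma DependsOnlyOn.update {g : BoolFun n} {S : Finset (Fin n)} (hg : DependsOnlyOn g S)
    (i : Fin n) (b : ℤˣ) : DependsOnlyOn (fun x => g (Function.update x i b)) (S.erase i) := by
  intro x y hxy
  refine hg _ _ fun j hj => ?_
  by_cases hji : j = i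
  · subst hji; simp
  · rw [Function.update_of_ne hji, Function.update_of_ne hji]
    exact hxy j (Finset.mem_erase.2 ⟨hji, hj⟩)

/-- A junta on `S` can be replaced by a junta on a set of relevant coordinates at a small loss. -/
lemma exists_relevant_junta (f : BoolFun n) (γ : ℝ) (hγ : 0 ≤ γ) (S : Finset (Fin n)) :
    ∀ g : BoolFun n, DependsOnlyOn g S → ∃ S' ⊆ S, ∃ g' : BoolFun n, DependsOnlyOn g' S' ∧
      𝔼 x, val (f x) * val (g x) - γ * S.card ≤ 𝔼 x, val (f x) * val (g' x) ∧
      ∀ i ∈ S', Relevant f γ (S'.erase i) i := by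
  induction S using Finset.strongInduction with
  | H S ih =>
    intro g hg
    by_cases hall : ∀ i ∈ S, Relevant f γ (S.erase i) i
    · exact ⟨S, subset_rfl, g, hg, sub_le_self _ (by positivity), hall⟩
    · push Not at hall
      obtain ⟨i, hi, hrel⟩ := hall
      set g₁ : BoolFun n := fun x => g (Function.update x i 1)
      set g₂ : BoolFun n := fun x => g (Function.update x i (-1))
      have hu : 𝔼 x, val (f x) * val (x i) * ((val (g₁ x) - val (g₂ x)) / 2) < γ := by
        by_contra hc
        push Not at hc
        refine hrel ⟨fun x => (val (g₁ x) - val (g₂ x)) / 2, fun x => ?_, fun x y hxy => ?_, hc⟩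
        · change |(val (g₁ x) - val (g₂ x)) / 2| ≤ 1
          rcases val_cases (g₁ x) with h1 | h1 <;> rcases val_cases (g₂ x) with h2 | h2 <;>
            rw [h1, h2] <;> norm_num
        · have e1 : g₁ x = g₁ y := hg.update i 1 x y hxy
          have e2 : g₂ x = g₂ y := hg.update i (-1) x y hxy
          simp only [e1, e2]
      -- Pointwise `g = x_i (g₁ - g₂) / 2 + (g₁ + g₂) / 2`. The first part correlates less than `γ`
      -- with `f`, so fixing `x_i` to the better sign loses at most `γ`.
      have hsplit : 𝔼 x, val (f x) * val (g x) =
          𝔼 x, val (f x) * val (x i) * ((val (g₁ x) - val (g₂ x)) / 2) +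
          (𝔼 x, val (f x) * val (g₁ x) + 𝔼 x, val (f x) * val (g₂ x)) / 2 := by
        rw [← Finset.expect_add_distrib, Finset.expect_div, ← Finset.expect_add_distrib]
        refine Finset.expect_congr rfl fun x _ => ?_
        rcases Int.units_eq_one_or (x i) with hx | hx
        · have : g₁ x = g x := by simp only [g₁, ← hx, Function.update_eq_self]
          rw [this, hx, val_one]; ring
        · have : g₂ x = g x := by simp only [g₂, ← hx, Function.update_eq_self]
          rw [this, hx, val_neg, val_one]; ring
      have hex : ∃ b : ℤˣ, 𝔼 x, val (f x) * val (g x) - γ ≤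
          𝔼 x, val (f x) * val (g (Function.update x i b)) := by
        by_contra hc
        push Not at hc
        have h1 := hc 1
        have h2 := hc (-1)
        linarith
      obtain ⟨b, hb⟩ := hex
      obtain ⟨S', hS', g', hg', hle, hrel'⟩ := ih _ (Finset.erase_ssubset hi) _ (hg.update i b)
      refine ⟨S', hS'.trans (Finset.erase_subset _ _), g', hg', le_trans ?_ hle, hrel'⟩
      have : (S.card : ℝ) = (S.erase i).card + 1 := by
        exact_mod_cast (Finset.card_erase_add_one hi).symm
      rw [this]; linarith

/-- The odd part of a Boolean function. -/
noncomputable def oddPart (g : BoolFun n) (x : Cube n) : ℝ := (val (g x) - val (g (-x))) / 2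

lemma abs_oddPart_le (g : BoolFun n) (x : Cube n) : |oddPart g x| ≤ 1 := by
  unfold oddPart
  rcases val_cases (g x) with h1 | h1 <;> rcases val_cases (g (-x)) with h2 | h2 <;>
    rw [h1, h2] <;> norm_num

lemma oddPart_neg (g : BoolFun n) (x : Cube n) : oddPart g (-x) = -oddPart g x := by
  simp only [oddPart, neg_neg]; ring

lemma fourier_oddPart_singleton (g : BoolFun n) (i : Fin n) :
    fourier (oddPart g) {i} = 𝔼 x, val (g x) * val (x i) := by
  have h := expect_comp_neg fun x => val (g x) * val (x i)
  simp only [Pi.neg_apply, val_neg, mul_neg, Finset.expect_neg_distrib] at h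
  have h2 : fourier (oddPart g) {i} =
      (𝔼 x, val (g x) * val (x i) - 𝔼 x, val (g (-x)) * val (x i)) / 2 := by
    rw [← Finset.expect_sub_distrib, Finset.expect_div, fourier]
    exact Finset.expect_congr rfl fun x _ => by rw [walsh_singleton, oddPart]; ring
  linarith

lemma expect_val_mul_coord (g : BoolFun n) (i : Fin n) (σ : ℤˣ) :
    val σ * 𝔼 x, val (g x) * val (x i) = 1 - 2 * pr (fun x => g x ≠ σ * x i) := by
  rw [← expect_val_mul_val, Finset.mul_expect]
  exact Finset.expect_congr rfl fun x _ => by rw [val_mul]; ring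

lemma NearDictator.le_abs_fourier {g : BoolFun n} {i : Fin n} {κ : ℝ} (h : NearDictator g i κ) :
    1 - 2 * κ ≤ |fourier (oddPart g) {i}| := by
  obtain ⟨σ, hσ⟩ := h
  have h1 := expect_val_mul_coord g i σ
  rw [← fourier_oddPart_singleton] at h1
  have h2 : |fourier (oddPart g) {i}| = |val σ * fourier (oddPart g) {i}| := by
    rw [abs_mul, abs_val, one_mul]
  rw [h2, h1]
  exact le_trans (by linarith) (le_abs_self _)

lemma nearDictator_of_le_abs_fourier {g : BoolFun n} {i : Fin n} {κ : ℝ}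
    (h : 1 - 2 * κ ≤ |fourier (oddPart g) {i}|) : NearDictator g i κ := by
  rw [fourier_oddPart_singleton] at h
  rcases le_abs.1 h with h1 | h1
  · refine ⟨1, ?_⟩
    have h2 := expect_val_mul_coord g i 1
    rw [val_one] at h2; linarith
  · refine ⟨-1, ?_⟩
    have h2 := expect_val_mul_coord g i (-1)
    rw [val_neg, val_one] at h2; linarith

variable {L k : ℕ}

/-- One of the given functions, or the constant `1`. -/
def feature (G : Fin L → BoolFun n) : Option (Fin L) → BoolFun n
  | none => fun _ => 1
  | some j => G j

/-- A function of at most `k` of the given functions. -/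
def composite (G : Fin L → BoolFun n) (a : Fin k → Option (Fin L))
    (φ : (Fin k → ℤˣ) → ℤˣ) : BoolFun n := fun x => φ fun r => feature G (a r) x

lemma exists_junta_near_composite {G : Fin L → BoolFun n} {a : Fin k → Option (Fin L)}
    {κ : ℝ} (hκ : 0 ≤ κ) (h : ∀ r j, a r = some j → ∃ i, NearDictator (G j) i κ)
    (φ : (Fin k → ℤˣ) → ℤˣ) :
    ∃ g ∈ juntas n k, pr (fun x => composite G a φ x ≠ g x) ≤ k * κ := by
  have h1 : ∀ r, ∃ d : BoolFun n, ∃ S : Finset (Fin n), S.card ≤ 1 ∧ DependsOnlyOn d S ∧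
      pr (fun x => feature G (a r) x ≠ d x) ≤ κ := by
    intro r
    rcases har : a r with _ | j
    · refine ⟨fun _ => 1, ∅, by simp, fun _ _ _ => rfl, ?_⟩
      simpa [feature, pr, ind] using hκ
    · obtain ⟨i, σ, hσ⟩ := h r j har
      exact ⟨fun x => σ * x i, {i}, by simp, fun x y hxy =>
        congrArg (σ * ·) (hxy i (Finset.mem_singleton_self i)), hσ⟩
  choose d S hS hd hpr using h1
  refine ⟨fun x => φ fun r => d r x, ⟨Finset.univ.biUnion S, ?_, fun x y hxy => ?_⟩, ?_⟩
  · exact (Finset.card_biUnion_le_card_mul _ _ 1 fun r _ => hS r).trans (by simp)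
  · have : (fun r => d r x) = fun r => d r y := funext fun r => hd r x y fun i hi =>
      hxy i (Finset.mem_biUnion.2 ⟨r, Finset.mem_univ r, hi⟩)
    simp only [this]
  · have h2 : pr (fun x => composite G a φ x ≠ φ fun r => d r x) ≤
        pr (fun x => ∃ r, feature G (a r) x ≠ d r x) := pr_mono fun x hx => by
      by_contra hc
      push Not at hc
      exact hx (congrArg φ (funext hc))
    refine h2.trans ((pr_exists_le _).trans ((Finset.sum_le_sum fun r _ => hpr r).trans ?_))
    simp

lemma exists_composite_near_junta {G : Fin L → BoolFun n} {S : Finset (Fin n)} (hS : S.card ≤ k)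
    {g : BoolFun n} (hg : DependsOnlyOn g S) {κ : ℝ} (hκ : 0 ≤ κ)
    (h : ∀ i ∈ S, ∃ j, NearDictator (G j) i κ) :
    ∃ (a : Fin k → Option (Fin L)) (φ : (Fin k → ℤˣ) → ℤˣ),
      (∀ r j, a r = some j → ∃ i, NearDictator (G j) i κ) ∧
      pr (fun x => g x ≠ composite G a φ x) ≤ k * κ := by
  have h1 : ∀ i : S, ∃ j, ∃ σ : ℤˣ, pr (fun x => G j x ≠ σ * x i) ≤ κ := fun i => h i i.2
  choose j σ hpr using h1
  obtain ⟨e⟩ : Nonempty (S ↪ Fin k) :=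
    Function.Embedding.nonempty_of_card_le (by simpa using hS)
  -- Unused slots carry the constant. The function `φ` undoes the signs of the oracles and feeds the
  -- result to `g`; the value `1` off `S` is immaterial since `g` ignores it.
  refine ⟨Function.extend e (fun i => some (j i)) (fun _ => none),
    fun y => g fun i => if hi : i ∈ S then σ ⟨i, hi⟩ * y (e ⟨i, hi⟩) else 1, ?_, ?_⟩
  · intro r t hr
    by_cases her : ∃ i, e i = r
    · obtain ⟨i, rfl⟩ := her
      rw [e.injective.extend_apply] at hr
      obtain rfl := Option.some.inj hr
      exact ⟨i, σ i, hpr i⟩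
    · rw [Function.extend_apply' _ _ _ her] at hr
      cases hr
  · refine (pr_mono (q := fun x => ∃ i : S, G (j i) x ≠ σ i * x i) fun x hx => ?_).trans
      ((pr_exists_le _).trans ((Finset.sum_le_sum fun i _ => hpr i).trans ?_))
    · by_contra hc
      push Not at hc
      refine hx (hg _ _ fun i hi => ?_)
      simp only [dif_pos hi, e.injective.extend_apply, feature, hc ⟨i, hi⟩]
      rw [← mul_assoc, Int.units_mul_self, one_mul]
    · simp only [Finset.sum_const, Finset.card_univ, Fintype.card_coe, nsmul_eq_mul]
      have : (S.card : ℝ) ≤ k := by exact_mod_cast hS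
      gcongr

variable {N' N : ℕ}

/-- The final stage of the tester: with the oracles `G`, the samples `τ` for the dictatorship test
and `ξ` for the estimation of correlations, decide whether some composite of oracles that pass the
dictatorship test with threshold `θ'` has an empirical correlation of at least `θ` with `f`. -/
def Accepts (k : ℕ) (θ' θ : ℝ) (f : BoolFun n) (G : Fin L → BoolFun n) (τ : Fin N' → TestSeed n)
    (ξ : Fin N → Cube n) : Prop :=
  ∃ (a : Fin k → Option (Fin L)) (φ : (Fin k → ℤˣ) → ℤˣ),
    (∀ r j, a r = some j → θ' ≤ |emp (testValue (oddPart (G j))) τ|) ∧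
    θ ≤ emp (fun x => val (f x) * val (composite G a φ x)) ξ

/-- Some dictatorship test has an empirical value that is off by at least `η`. -/
def TestDeviates (η : ℝ) (G : Fin L → BoolFun n) (τ : Fin N' → TestSeed n) : Prop :=
  ∃ j, η ≤ |emp (testValue (oddPart (G j))) τ - 𝔼 s, testValue (oddPart (G j)) s|

/-- Some composite has an empirical correlation that is off by at least `η`. -/
def CorrelationDeviates (k : ℕ) (η : ℝ) (f : BoolFun n) (G : Fin L → BoolFun n)
    (ξ : Fin N → Cube n) : Prop :=
  ∃ p : (Fin k → Option (Fin L)) × ((Fin k → ℤˣ) → ℤˣ),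
    η ≤ |emp (fun x => val (f x) * val (composite G p.1 p.2 x)) ξ -
      𝔼 x, val (f x) * val (composite G p.1 p.2 x)|

lemma abs_testValue_le {G : Cube n → ℝ} (hG : ∀ x, |G x| ≤ 1) (s : TestSeed n) :
    |testValue G s| ≤ 1 := by
  rw [testValue, abs_mul, abs_mul]
  exact mul_le_one₀ (mul_le_one₀ (hG _) (abs_nonneg _) (hG _)) (abs_nonneg _) (hG _)

lemma pr_testDeviates_le {η : ℝ} (hη : 0 < η) (hN : 0 < N') (G : Fin L → BoolFun n) :
    pr (fun τ : Fin N' → TestSeed n => TestDeviates η G τ) ≤ L * (1 / (N' * η ^ 2)) := by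
  refine (pr_exists_le _).trans ((Finset.sum_le_sum fun j _ =>
    pr_emp_dev hN (abs_testValue_le (abs_oddPart_le (G j))) hη).trans ?_)
  simp

/-- Union bound over all choices of `k` features and all truth tables on `k` bits. -/
lemma pr_correlationDeviates_le {η : ℝ} (hη : 0 < η) (hη4 : η ≤ 4) (hN : 0 < N) (f : BoolFun n)
    (G : Fin L → BoolFun n) :
    pr (fun ξ : Fin N → Cube n => CorrelationDeviates k η f G ξ) ≤
      ((L : ℝ) + 1) ^ k * 2 ^ 2 ^ k * (2 * Real.exp (-(N * η ^ 2 / 16))) := by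
  refine (pr_exists_le _).trans ((Finset.sum_le_sum fun p _ =>
    pr_emp_abs_ge hN (fun x => ?_) hη hη4).trans ?_)
  · rw [abs_mul, abs_val, abs_val, one_mul]
  · rw [Finset.sum_const, Finset.card_univ, nsmul_eq_mul]
    apply le_of_eq
    simp

/-- Soundness: every oracle that passes is near some signed coordinate, so the accepted composite is
near a `k`-junta. -/
lemma Accepts.exists_junta {θ' θ η η' κ : ℝ} {f : BoolFun n} {G : Fin L → BoolFun n}
    {τ : Fin N' → TestSeed n} {ξ : Fin N → Cube n} (h : Accepts k θ' θ f G τ ξ)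
    (hτ : ¬TestDeviates η' G τ) (hξ : ¬CorrelationDeviates k η f G ξ)
    (hκ0 : 0 ≤ κ) (hκ : κ < 3 / 8) (hθ' : 1 / 2 - κ ≤ θ' - η') :
    ∃ g ∈ juntas n k, θ - η - 2 * (k * κ) < 𝔼 x, val (f x) * val (g x) := by
  obtain ⟨a, φ, ha, hφ⟩ := h
  obtain ⟨g, hg, hpr⟩ := exists_junta_near_composite hκ0 (fun r j hrj => by
    have h1 := ha r j hrj
    have h2 : |emp (testValue (oddPart (G j))) τ - 𝔼 s, testValue (oddPart (G j)) s| < η' := by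
      by_contra hc
      exact hτ ⟨j, not_lt.1 hc⟩
    have h3 := abs_sub_abs_le_abs_sub (emp (testValue (oddPart (G j))) τ)
      (𝔼 s, testValue (oddPart (G j)) s)
    obtain ⟨i, hi⟩ := exists_fourier_singleton_of_expect_testValue (abs_oddPart_le (G j))
      (oddPart_neg (G j)) hκ (by linarith)
    exact ⟨i, nearDictator_of_le_abs_fourier hi⟩) φ
  refine ⟨g, hg, ?_⟩
  have h1 := expect_mul_val_le_add f (composite G a φ) g
  have h2 : |emp (fun x => val (f x) * val (composite G a φ x)) ξ -
      𝔼 x, val (f x) * val (composite G a φ x)| < η := by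
    by_contra hc
    exact hξ ⟨(a, φ), not_lt.1 hc⟩
  have h3 := (abs_lt.1 h2).2
  linarith

/-- Completeness: oracles capturing the coordinates of `g` pass the test, and a composite of them
imitates `g`. -/
lemma accepts_of_nearDictator {θ' θ η η' κ : ℝ} {f : BoolFun n} {G : Fin L → BoolFun n}
    {τ : Fin N' → TestSeed n} {ξ : Fin N → Cube n}
    (hτ : ¬TestDeviates η' G τ) (hξ : ¬CorrelationDeviates k η f G ξ)
    {S : Finset (Fin n)} (hS : S.card ≤ k) {g : BoolFun n} (hg : DependsOnlyOn g S)
    (hκ0 : 0 ≤ κ) (hκ1 : 2 * κ ≤ 1) (h : ∀ i ∈ S, ∃ j, NearDictator (G j) i κ)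
    (hθ' : θ' + η' ≤ 1 / 2 - 8 * κ)
    (hθ : θ + η + 2 * (k * κ) ≤ 𝔼 x, val (f x) * val (g x)) : Accepts k θ' θ f G τ ξ := by
  obtain ⟨a, φ, ha, hpr⟩ := exists_composite_near_junta hS hg hκ0 h
  refine ⟨a, φ, fun r j hrj => ?_, ?_⟩
  · obtain ⟨i, hi⟩ := ha r j hrj
    have h1 := le_abs_expect_testValue (abs_oddPart_le (G j)) (by linarith) hκ1 hi.le_abs_fourier
    have h2 : |emp (testValue (oddPart (G j))) τ - 𝔼 s, testValue (oddPart (G j)) s| < η' := by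
      by_contra hc
      exact hτ ⟨j, not_lt.1 hc⟩
    have h3 := abs_sub_abs_le_abs_sub (𝔼 s, testValue (oddPart (G j)) s)
      (emp (testValue (oddPart (G j))) τ)
    rw [abs_sub_comm] at h3
    linarith
  · have h1 := expect_mul_val_le_add f g (composite G a φ)
    have h2 : |emp (fun x => val (f x) * val (composite G a φ x)) ξ -
        𝔼 x, val (f x) * val (composite G a φ x)| < η := by
      by_contra hc
      exact hξ ⟨(a, φ), not_lt.1 hc⟩
    have h3 := (abs_lt.1 h2).1
    linarith

end Hypotheses

/-! ### Realization as query algorithms, and failure probabilities. -/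

section Queries

variable {n : ℕ}

/-- The tree reads the points of `l` and records the answers by updating the default function `b`,
to which `D` is applied at the leaf. If `D` only looks at these points, the default does not matter.
-/
lemma exists_queryTree_of_list (D : BoolFun n → Bool) (l : List (Cube n)) : ∀ b : BoolFun n,
    ∃ t : QueryTree n, (∀ f, t.run f = D fun x => if x ∈ l then f x else b x) ∧
      ∀ f, t.queryCount f ≤ l.length := by
  induction l with
  | nil => exact fun b => ⟨.verdict (D b), fun f => by simp [QueryTree.run],
      fun f => by simp [QueryTree.queryCount]⟩
  | cons x l ih =>
    intro b
    choose t ht hc using fun v => ih (Function.update b x v)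
    refine ⟨.query x t, fun f => ?_, fun f => ?_⟩
    · rw [QueryTree.run, ht]
      congr 1
      funext y
      by_cases hyl : y ∈ l
      · simp [hyl]
      · by_cases hyx : y = x
        · subst hyx; simp [hyl]
        · simp [hyl, hyx]
    · rw [QueryTree.queryCount, List.length_cons]
      exact Nat.add_le_add_right (hc _ f) 1

lemma exists_queryTree (D : BoolFun n → Bool) (Q : Finset (Cube n))
    (hD : ∀ f f' : BoolFun n, (∀ x ∈ Q, f x = f' x) → D f = D f') :
    ∃ t : QueryTree n, (∀ f, t.run f = D f) ∧ ∀ f, t.queryCount f ≤ Q.card := by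
  obtain ⟨t, ht, hc⟩ := exists_queryTree_of_list D Q.toList fun _ => 1
  refine ⟨t, fun f => ?_, fun f => by simpa using hc f⟩
  rw [ht]
  exact hD _ _ fun x hx => by simp [hx]

/-- A randomized nonadaptive decision procedure can be realized as a query algorithm. -/
lemma exists_randomizedQueryAlgorithm {Ω : Type*} [Fintype Ω] [Nonempty Ω]
    (D : Ω → BoolFun n → Bool) (Q : Ω → Finset (Cube n)) {q : ℕ} (hq : ∀ ω, (Q ω).card ≤ q)
    (hD : ∀ ω, ∀ f f' : BoolFun n, (∀ x ∈ Q ω, f x = f' x) → D ω f = D ω f') :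
    ∃ T : RandomizedQueryAlgorithm n, T.MakesAtMost q ∧
      ∀ f b, T.prob f b = ENNReal.ofReal (pr fun ω => D ω f = b) := by
  choose t ht hc using fun ω => exists_queryTree (D ω) (Q ω) (hD ω)
  refine ⟨PMF.map t (PMF.uniformOfFintype Ω), fun s hs f => ?_, fun f b => ?_⟩
  · obtain ⟨ω, -, rfl⟩ := (PMF.mem_support_map_iff _ _ _).1 hs
    exact (hc ω f).trans (hq ω)
  · have hcard : (0 : ℝ) < Fintype.card Ω := by exact_mod_cast Fintype.card_pos
    rw [pr_eq_card_div, ENNReal.ofReal_div_of_pos hcard, ENNReal.ofReal_natCast,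
      ENNReal.ofReal_natCast, RandomizedQueryAlgorithm.prob, PMF.map_comp, PMF.map_apply,
      tsum_fintype, div_eq_mul_inv, ← nsmul_eq_mul, ← Finset.sum_const, Finset.sum_filter]
    refine Finset.sum_congr rfl fun ω _ => ?_
    simp only [Function.comp, ht, PMF.uniformOfFintype_apply, eq_comm (a := b)]

variable {r m M L N N' k : ℕ}

/-- The `t`-th query of an approximate coordinate oracle. -/
def gadgetQuery (s : GadgetSeed n r m M) (x : Cube n) (t : Fin M) : Cube n :=
  (zeros s.1.1).piecewise ((zeros s.2.1).piecewise x (s.2.2 t)) s.1.2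

lemma response_congr {f f' : BoolFun n} {s : GadgetSeed n r m M} {x : Cube n}
    (h : ∀ t, f (gadgetQuery s x t) = f' (gadgetQuery s x t)) :
    response f s x = response f' s x := by
  simp only [response, blockMean, emp]
  congr 1
  exact Finset.sum_congr rfl fun t _ => congrArg val (h t)

lemma gadget_congr {f f' : BoolFun n} {s : GadgetSeed n r m M} {x : Cube n}
    (h : ∀ t, f (gadgetQuery s x t) = f' (gadgetQuery s x t))
    (h' : ∀ t, f (gadgetQuery s (-x) t) = f' (gadgetQuery s (-x) t)) :
    gadget f s x = gadget f' s x := by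
  rw [gadget, gadget, roundOdd, roundOdd, response_congr h, response_congr h']

/-- The random choices of the tester. -/
abbrev TesterSeed (n r m M L N' N : ℕ) : Type :=
  (Fin L → GadgetSeed n r m M) × (Fin N' → TestSeed n) × (Fin N → Cube n)

/-- The points at which the tester evaluates the approximate coordinate oracles, up to sign. -/
def oraclePoint (ω : TesterSeed n r m M L N' N) : Fin N ⊕ Fin N' × Fin 3 → Cube n
  | .inl s => ω.2.2 s
  | .inr (s, c) => ![(ω.2.1 s).1, (ω.2.1 s).2.1, thirdPoint (ω.2.1 s)] c

/-- The points at which the tester queries the unknown function. -/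
def testerQueries (ω : TesterSeed n r m M L N' N) : Finset (Cube n) :=
  Finset.univ.image ω.2.2 ∪
  (Finset.univ : Finset ((Fin N ⊕ Fin N' × Fin 3) × Fin L × Bool × Fin M)).image fun p =>
    gadgetQuery (ω.1 p.2.1) (if p.2.2.1 then oraclePoint ω p.1 else -oraclePoint ω p.1) p.2.2.2

lemma card_testerQueries_le (ω : TesterSeed n r m M L N' N) :
    (testerQueries ω).card ≤ N + (N + N' * 3) * (L * (2 * M)) := by
  refine (Finset.card_union_le _ _).trans (add_le_add ?_ ?_)
  · exact Finset.card_image_le.trans (by simp)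
  · exact Finset.card_image_le.trans (by simp)

/-- Both signs are needed: rounding compares the responses at a point and its negative, and
`oddPart` evaluates the oracle at both. -/
lemma gadget_eq_of_eq_on_queries {ω : TesterSeed n r m M L N' N} {f f' : BoolFun n}
    (h : ∀ x ∈ testerQueries ω, f x = f' x) (b : Fin N ⊕ Fin N' × Fin 3) (j : Fin L) :
    gadget f (ω.1 j) (oraclePoint ω b) = gadget f' (ω.1 j) (oraclePoint ω b) ∧
    gadget f (ω.1 j) (-oraclePoint ω b) = gadget f' (ω.1 j) (-oraclePoint ω b) := by
  have h1 : ∀ t, f (gadgetQuery (ω.1 j) (oraclePoint ω b) t) =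
      f' (gadgetQuery (ω.1 j) (oraclePoint ω b) t) := fun t => h _ (Finset.mem_union_right _
        (Finset.mem_image.2 ⟨(b, j, true, t), Finset.mem_univ _, by simp⟩))
  have h2 : ∀ t, f (gadgetQuery (ω.1 j) (-oraclePoint ω b) t) =
      f' (gadgetQuery (ω.1 j) (-oraclePoint ω b) t) := fun t => h _ (Finset.mem_union_right _
        (Finset.mem_image.2 ⟨(b, j, false, t), Finset.mem_univ _, by simp⟩))
  exact ⟨gadget_congr h1 h2, gadget_congr h2 (by simpa using h1)⟩

lemma accepts_congr {ω : TesterSeed n r m M L N' N} {f f' : BoolFun n}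
    (h : ∀ x ∈ testerQueries ω, f x = f' x) {θ' θ : ℝ}
    (hacc : Accepts k θ' θ f (fun j => gadget f (ω.1 j)) ω.2.1 ω.2.2) :
    Accepts k θ' θ f' (fun j => gadget f' (ω.1 j)) ω.2.1 ω.2.2 := by
  have hodd : ∀ j b, oddPart (gadget f (ω.1 j)) (oraclePoint ω b) =
      oddPart (gadget f' (ω.1 j)) (oraclePoint ω b) := fun j b => by
    rw [oddPart, oddPart, (gadget_eq_of_eq_on_queries h b j).1,
      (gadget_eq_of_eq_on_queries h b j).2]
  obtain ⟨a, φ, ha, hφ⟩ := hacc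
  refine ⟨a, φ, fun r j hrj => (ha r j hrj).trans_eq ?_, hφ.trans_eq ?_⟩
  · congr 1
    simp only [emp]
    congr 1
    refine Finset.sum_congr rfl fun s _ => ?_
    have h0 := hodd j (.inr (s, 0))
    have h1 := hodd j (.inr (s, 1))
    have h2 := hodd j (.inr (s, 2))
    simp only [oraclePoint, Matrix.cons_val_zero, Matrix.cons_val_one, Matrix.cons_val] at h0 h1 h2
    simp only [testValue, h0, h1, h2]
  · simp only [emp]
    congr 1
    refine Finset.sum_congr rfl fun s _ => ?_
    have h1 : f (ω.2.2 s) = f' (ω.2.2 s) := h _ (Finset.mem_union_left _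
      (Finset.mem_image.2 ⟨s, Finset.mem_univ _, rfl⟩))
    have h2 : ∀ o, feature (fun j => gadget f (ω.1 j)) o (ω.2.2 s) =
        feature (fun j => gadget f' (ω.1 j)) o (ω.2.2 s) := by
      rintro (_ | j)
      · rfl
      · exact (gadget_eq_of_eq_on_queries h (.inl s) j).1
    simp only [composite, h1, h2]

lemma pr_snd {Ω Ω' : Type*} [Fintype Ω] [Fintype Ω'] [Nonempty Ω] (p : Ω' → Prop) :
    pr (fun ω : Ω × Ω' => p ω.2) = pr p := by
  unfold pr
  rw [expect_prod_type]
  simp only [Fintype.expect_const]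

/-- One of the estimates made by the tester is off. -/
def Deviates (k : ℕ) (η' η : ℝ) (f : BoolFun n) (ω : TesterSeed n r m M L N' N) : Prop :=
  TestDeviates η' (fun j => gadget f (ω.1 j)) ω.2.1 ∨
    CorrelationDeviates k η f (fun j => gadget f (ω.1 j)) ω.2.2

/-- The test and correlation samples are independent of the oracles, so the union bounds apply with
the oracles held fixed. -/
lemma pr_deviates_le {η' η : ℝ} (hη' : 0 < η') (hN' : 0 < N') (hη : 0 < η) (hη4 : η ≤ 4)
    (hN : 0 < N) (f : BoolFun n) :
    pr (fun ω : TesterSeed n r m M L N' N => Deviates k η' η f ω) ≤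
      L * (1 / (N' * η' ^ 2)) +
        ((L : ℝ) + 1) ^ k * 2 ^ 2 ^ k * (2 * Real.exp (-(N * η ^ 2 / 16))) := by
  refine pr_prod_le _ fun s => (pr_or_le _ _).trans (add_le_add ?_ ?_)
  · rw [pr_fst (Ω' := Fin N → Cube n)
      (fun τ : Fin N' → TestSeed n => TestDeviates η' (fun j => gadget f (s j)) τ)]
    exact pr_testDeviates_le hη' hN' _
  · rw [pr_snd (Ω := Fin N' → TestSeed n)
      (fun ξ : Fin N → Cube n => CorrelationDeviates k η f (fun j => gadget f (s j)) ξ)]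
    exact pr_correlationDeviates_le hη hη4 hN f _

/-- Some coordinate of `S` is not captured by any of the approximate coordinate oracles. -/
def Misses (κ : ℝ) (f : BoolFun n) (S : Finset (Fin n)) (ω : TesterSeed n r m M L N' N) : Prop :=
  ∃ i : S, ∀ j, ¬NearDictator (gadget f (ω.1 j)) i κ

lemma pr_misses_le {κ π : ℝ} (hπ : 0 < π) (hL : 0 < L) {f : BoolFun n} {S : Finset (Fin n)}
    (h : ∀ i ∈ S, π ≤ pr fun s : GadgetSeed n r m M => NearDictator (gadget f s) i κ) :
    pr (fun ω : TesterSeed n r m M L N' N => Misses κ f S ω) ≤ S.card * (1 / (π * L)) := by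
  refine (pr_exists_le _).trans ((Finset.sum_le_sum (g := fun _ => 1 / (π * L))
    fun i _ => ?_).trans (by simp))
  rw [pr_fst (Ω' := (Fin N' → TestSeed n) × (Fin N → Cube n)) (fun s : Fin L → GadgetSeed n r m M =>
    ∀ j, ¬NearDictator (gadget f (s j)) i κ)]
  exact pr_pi_none_le (p := fun s : GadgetSeed n r m M => NearDictator (gadget f s) i κ) hπ
    (h i i.2) hL

end Queries

/-! ### Choice of parameters and the tester. -/

section Tester

/-- The sample size of the approximate coordinate oracles. -/
def averagingSize (K : ℕ) : ℕ := 16384 * K ^ 3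

/-- The number of approximate coordinate oracles. -/
def oracleCount (K : ℕ) : ℕ := 41943040 * K ^ 7

/-- The sample size of the dictatorship test. -/
def testSize (K : ℕ) : ℕ := 10240 * K ^ 2 * oracleCount K

/-- The sample size for the estimation of correlations. -/
def correlationSize (k K : ℕ) : ℕ := 2 ^ k * (256 * K ^ 2 * (K * oracleCount K + 11))

/-- The random choices of the tester with the above parameters. -/
abbrev Seed (n k K : ℕ) : Type :=
  TesterSeed n (2 * k) (averagingSize K) (averagingSize K) (oracleCount K) (testSize K)
    (correlationSize k K)

variable {n k K : ℕ}

/-- The source of the factor `2 ^ k`: the sample must beat `2 ^ 2 ^ k` truth tables. The term `K *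
L` in its size pays for the choices of oracles, and `11` for the truth tables, the factor `2` and
the final slack. -/
lemma exp_deviation_le {ε : ℝ} (hk : k ≤ K) (hK : 1 ≤ K) (hKε : 1 ≤ K * ε) :
    ((oracleCount K : ℝ) + 1) ^ k * 2 ^ 2 ^ k *
      (2 * Real.exp (-(correlationSize k K * (ε / 4) ^ 2 / 16))) ≤ 1 / 10 := by
  set L : ℝ := (oracleCount K : ℝ) with hL
  have hL0 : 0 ≤ L := Nat.cast_nonneg _
  have hK' : (1 : ℝ) ≤ K := by exact_mod_cast hK
  have hk' : (k : ℝ) ≤ K := by exact_mod_cast hk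
  have h1 : (L + 1) ^ k ≤ Real.exp (K * L) := by
    refine (pow_le_pow_left₀ (by positivity) (Real.add_one_le_exp L) k).trans ?_
    rw [← Real.exp_nat_mul]
    gcongr
  have h2e : (2 : ℝ) ≤ Real.exp 1 := by linarith [Real.add_one_le_exp (1 : ℝ)]
  have h2 : (2 : ℝ) ^ 2 ^ k ≤ Real.exp (2 ^ k) := by
    refine (pow_le_pow_left₀ (by norm_num) h2e _).trans ?_
    rw [← Real.exp_nat_mul]
    simp
  have h3 : (2 : ℝ) ^ k * (K * L + 11) ≤ correlationSize k K * (ε / 4) ^ 2 / 16 := by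
    have : (correlationSize k K : ℝ) * (ε / 4) ^ 2 / 16 =
        2 ^ k * (K * L + 11) * (K * ε) ^ 2 := by
      simp only [correlationSize, hL]; push_cast; ring
    rw [this]
    exact le_mul_of_one_le_right (by positivity) (one_le_pow₀ hKε)
  have h4 : (1 : ℝ) ≤ 2 ^ k := one_le_pow₀ (by norm_num)
  calc (L + 1) ^ k * 2 ^ 2 ^ k * (2 * Real.exp (-(correlationSize k K * (ε / 4) ^ 2 / 16)))
      ≤ Real.exp (K * L) * Real.exp (2 ^ k) *
        (Real.exp 1 * Real.exp (-(2 ^ k * (K * L + 11)))) := by gcongr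
    _ = Real.exp (K * L + 2 ^ k + 1 - 2 ^ k * (K * L + 11)) := by
        rw [← Real.exp_add, ← Real.exp_add, ← Real.exp_add]; congr 1; ring
    _ ≤ Real.exp (-9) := by
        apply Real.exp_le_exp.2
        nlinarith [mul_nonneg (sub_nonneg.2 h4) (mul_nonneg (by linarith : (0 : ℝ) ≤ K) hL0)]
    _ ≤ 1 / 10 := by
        rw [Real.exp_neg, ← one_div]
        exact one_div_le_one_div_of_le (by norm_num) (by linarith [Real.add_one_le_exp (9 : ℝ)])

lemma pr_deviates_seed_le {ε : ℝ} (hk : k ≤ K) (hK : 1 ≤ K) (hKε : 1 ≤ K * ε) (hε : ε ≤ 1)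
    (f : BoolFun n) :
    pr (fun ω : Seed n k K => Deviates k (1 / (32 * K)) (ε / 4) f ω) ≤ 1 / 5 := by
  have hK' : (1 : ℝ) ≤ K := by exact_mod_cast hK
  have hε0 : 0 < ε := pos_of_mul_pos_right (by linarith) (by linarith : (0 : ℝ) ≤ K)
  have hL : 0 < oracleCount K := by unfold oracleCount; positivity
  have hN' : 0 < testSize K := by unfold testSize; positivity
  have hN : 0 < correlationSize k K := by unfold correlationSize; positivity
  refine (pr_deviates_le (by positivity) hN' (by positivity) (by linarith) hN f).trans ?_
  have h1 := exp_deviation_le hk hK hKε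
  have h2 : (oracleCount K : ℝ) * (1 / (testSize K * (1 / (32 * K)) ^ 2)) = 1 / 10 := by
    have hL' : (0 : ℝ) < oracleCount K := by exact_mod_cast hL
    simp only [testSize]
    push_cast
    field_simp
    norm_num
  rw [h2]
  linarith

lemma le_pr_nearDictator_seed (hK : 1 ≤ K) (hkK : k + 1 ≤ K) {f : BoolFun n}
    {S : Finset (Fin n)} {i : Fin n} (hi : i ∉ S) (hS : S.card ≤ k)
    (h : Relevant f (1 / (4 * K)) S i) :
    1 / (4194304 * (K : ℝ) ^ 6) ≤
      pr (fun s : GadgetSeed n (2 * k) (averagingSize K) (averagingSize K) =>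
        NearDictator (gadget f s) i (1 / (128 * K))) := by
  have hK' : (1 : ℝ) ≤ K := by exact_mod_cast hK
  have hkK' : (k : ℝ) + 1 ≤ K := by exact_mod_cast hkK
  have hM : 0 < averagingSize K := by unfold averagingSize; positivity
  have hM' : (averagingSize K : ℝ) = 16384 * K ^ 3 := by simp [averagingSize]
  have hM1 : (1 : ℝ) ≤ averagingSize K := by exact_mod_cast hM
  -- With `δ = 1 / (256 K)` the closeness is `2δ = 1 / (128 K)`, and `averagingSize` makes the error
  -- condition tight after the bound `1 / (m + 1) ≤ 1 / m`. Taking `r = 2k` meets `2 |S| ≤ r + 1`.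
  have h1 := le_pr_nearDictator (r := 2 * k) (m := averagingSize K) (γ := 1 / (4 * (K : ℝ)))
    (δ := 1 / (256 * K)) (by positivity) (by positivity) hM hi h (by omega) (by
      have : 1 / ((averagingSize K : ℝ) + 1) ≤ 1 / averagingSize K :=
        one_div_le_one_div_of_le (by positivity) (by linarith)
      calc 1 / (1 / (256 * (K : ℝ))) * (1 / averagingSize K + 1 / ((averagingSize K : ℝ) + 1))
          ≤ 1 / (1 / (256 * (K : ℝ))) * (1 / averagingSize K + 1 / averagingSize K) := by gcongr
        _ = (1 / (4 * (K : ℝ))) ^ 2 / 2 := by rw [hM']; field_simp; norm_num)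
  have h2 : 2 * (1 / (256 * (K : ℝ))) = 1 / (128 * K) := by field_simp; norm_num
  rw [h2] at h1
  refine le_trans ?_ h1
  have h3 : 1 / (2 * (K : ℝ)) ≤ 1 / (((2 * k : ℕ) : ℝ) + 1) := by
    push_cast
    exact one_div_le_one_div_of_le (by positivity) (by linarith)
  have h4 : 1 / (2 * (averagingSize K : ℝ)) ≤ 1 / ((averagingSize K : ℝ) + 1) :=
    one_div_le_one_div_of_le (by positivity) (by linarith)
  calc 1 / (4194304 * (K : ℝ) ^ 6) =
      1 / (2 * (K : ℝ)) / 2 *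
        (1 / (2 * (averagingSize K : ℝ)) * ((1 / (4 * (K : ℝ))) ^ 2 / 2)) := by
        rw [hM']; field_simp; norm_num
    _ ≤ _ := by gcongr

lemma pr_misses_seed_le (hK : 1 ≤ K) (hkK : k + 1 ≤ K) {f : BoolFun n}
    {S : Finset (Fin n)} (hS : S.card ≤ k)
    (h : ∀ i ∈ S, Relevant f (1 / (4 * K)) (S.erase i) i) :
    pr (fun ω : Seed n k K => Misses (1 / (128 * K)) f S ω) ≤ 1 / 10 := by
  have hK' : (0 : ℝ) < K := by exact_mod_cast hK
  refine (pr_misses_le (π := 1 / (4194304 * (K : ℝ) ^ 6)) (by positivity)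
    (by unfold oracleCount; positivity) fun i hi => le_pr_nearDictator_seed hK hkK
      (Finset.notMem_erase i S) ((Finset.card_erase_le).trans hS) (h i hi)).trans ?_
  have hS' : (S.card : ℝ) ≤ K := by exact_mod_cast hS.trans (by omega)
  -- Each coordinate is missed with probability at most `1 / (10 K)`, and there are at most `K` of
  -- them.
  have : 1 / (1 / (4194304 * (K : ℝ) ^ 6) * (oracleCount K : ℝ)) = 1 / (10 * K) := by
    simp only [oracleCount]; push_cast; field_simp; norm_num
  rw [this, mul_one_div, div_le_div_iff₀ (by positivity) (by norm_num)]
  linarith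

/-- The verdict of the tester. -/
noncomputable def verdict (k K : ℕ) (θ : ℝ) (ω : Seed n k K) (f : BoolFun n) : Bool :=
  open Classical in
  decide (Accepts k (1 / 2 - 3 / (32 * K)) θ f (fun j => gadget f (ω.1 j)) ω.2.1 ω.2.2)

lemma verdict_eq_true_iff {θ : ℝ} {ω : Seed n k K} {f : BoolFun n} :
    verdict k K θ ω f = true ↔
      Accepts k (1 / 2 - 3 / (32 * K)) θ f (fun j => gadget f (ω.1 j)) ω.2.1 ω.2.2 := by
  classical exact decide_eq_true_iff

/-- The threshold `1 - cu - cl` is midway between `1 - 2 cl` and `1 - 2 cu`, leaving `cu - cl` on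
either side for the sampling error, the dropped coordinates and the imperfect oracles. -/
lemma le_pr_verdict_true {cu cl : ℝ} (hε : cu - cl ≤ 1) (hkK : k + 1 ≤ K)
    (hKε : k + 1 ≤ K * (cu - cl)) {f g : BoolFun n} (hg : g ∈ juntas n k) (hfg : dist f g ≤ cl) :
    2 / 3 ≤ pr (fun ω : Seed n k K => verdict k K (1 - cu - cl) ω f = true) := by
  have hK : 1 ≤ K := by omega
  have hK0 : (0 : ℝ) < K := by exact_mod_cast hK
  obtain ⟨S₀, hS₀, hgS₀⟩ := hg
  obtain ⟨S, hSS, g', hg', hcorr, hrel⟩ :=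
    exists_relevant_junta f (1 / (4 * K)) (by positivity) S₀ g hgS₀
  have hS : S.card ≤ k := (Finset.card_le_card hSS).trans hS₀
  have h1 := pr_misses_seed_le hK hkK hS hrel
  have h2 := pr_deviates_seed_le (n := n) (k := k) (by omega) hK
    (by linarith [(Nat.cast_nonneg k : (0 : ℝ) ≤ k)]) hε f
  have h3 : ∀ ω : Seed n k K, ¬verdict k K (1 - cu - cl) ω f = true →
      Misses (1 / (128 * K)) f S ω ∨ Deviates k (1 / (32 * K)) ((cu - cl) / 4) f ω := by
    intro ω hω
    by_contra hc
    rw [not_or, Deviates, not_or] at hc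
    obtain ⟨hmiss, htest, hdev⟩ := hc
    refine hω (verdict_eq_true_iff.2 (accepts_of_nearDictator (κ := 1 / (128 * K)) htest hdev hS hg'
      (by positivity) ?_ ?_ (le_of_eq ?_) ?_))
    · rw [mul_one_div, div_le_one (by positivity)]
      have : (1 : ℝ) ≤ K := by exact_mod_cast hK
      linarith
    · intro i hi
      by_contra hn
      push Not at hn
      exact hmiss ⟨⟨i, hi⟩, hn⟩
    · field_simp; ring
    · rw [expect_val_mul_val f g, ← dist_eq_pr] at hcorr
      have hkε : (k : ℝ) * (1 / K) ≤ cu - cl := by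
        rw [mul_one_div, div_le_iff₀ hK0]; linarith
      have hk0 : 0 ≤ (k : ℝ) * (1 / K) := by positivity
      have e1 : (k : ℝ) * (1 / (128 * K)) = k * (1 / K) / 128 := by field_simp
      have e2 : 1 / (4 * (K : ℝ)) * S₀.card ≤ k * (1 / K) / 4 := by
        have : (S₀.card : ℝ) ≤ k := by exact_mod_cast hS₀
        calc 1 / (4 * (K : ℝ)) * S₀.card ≤ 1 / (4 * (K : ℝ)) * k := by gcongr
          _ = _ := by field_simp
      rw [e1]
      linarith
  -- Failure has probability at most `1/10 + 1/5 < 1/3`.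
  have h4 := (pr_mono h3).trans (pr_or_le _ _)
  rw [pr_not (fun ω : Seed n k K => verdict k K (1 - cu - cl) ω f = true)] at h4
  linarith

/-- Only deviations can cause acceptance here: the sampling and rounding losses total at most `(cu -
cl) / 2`, less than the available gap. -/
lemma le_pr_verdict_false {cu cl : ℝ} (hε : cu - cl ≤ 1) (hkK : k + 1 ≤ K)
    (hKε : k + 1 ≤ K * (cu - cl)) {f : BoolFun n} (hf : ∀ g ∈ juntas n k, cu ≤ dist f g) :
    2 / 3 ≤ pr (fun ω : Seed n k K => verdict k K (1 - cu - cl) ω f = false) := by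
  have hK : 1 ≤ K := by omega
  have hK1 : (1 : ℝ) ≤ K := by exact_mod_cast hK
  have h2 := pr_deviates_seed_le (n := n) (k := k) (by omega) hK
    (by linarith [(Nat.cast_nonneg k : (0 : ℝ) ≤ k)]) hε f
  have h3 : ∀ ω : Seed n k K, ¬verdict k K (1 - cu - cl) ω f = false →
      Deviates k (1 / (32 * K)) ((cu - cl) / 4) f ω := by
    intro ω hω
    by_contra hc
    rw [Deviates, not_or] at hc
    have hacc := verdict_eq_true_iff.1 (Bool.eq_true_of_not_eq_false hω)
    obtain ⟨g, hg, hlt⟩ := hacc.exists_junta hc.1 hc.2 (κ := 1 / (8 * K)) (by positivity)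
      (by rw [div_lt_iff₀ (by positivity)]; linarith) (le_of_eq (by field_simp; ring))
    rw [expect_val_mul_val, ← dist_eq_pr] at hlt
    have hfg := hf g hg
    have hkε : (k : ℝ) * (1 / K) ≤ cu - cl := by
      rw [mul_one_div, div_le_iff₀ (by linarith)]; linarith
    have e1 : (k : ℝ) * (1 / (8 * K)) = k * (1 / K) / 8 := by field_simp
    rw [e1] at hlt
    have hpos : 0 < cu - cl := pos_of_mul_pos_right
      (lt_of_lt_of_le (by positivity) hKε) (by linarith : (0 : ℝ) ≤ K)
    linarith
  have h4 := pr_mono h3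
  rw [pr_not (fun ω : Seed n k K => verdict k K (1 - cu - cl) ω f = false)] at h4
  linarith

/-- The number of queries of the tester. -/
def queryBound (k K : ℕ) : ℕ :=
  correlationSize k K + (correlationSize k K + testSize K * 3) *
    (oracleCount K * (2 * averagingSize K))

/-- The sample sizes and the cost per point each contribute at most `K ^ 10`. -/
lemma queryBound_le (hK : 1 ≤ K) : queryBound k K ≤ 2 ^ k * (10 ^ 26 * K ^ 20) := by
  have h2 : 1 ≤ 2 ^ k := Nat.one_le_two_pow
  have h1 : correlationSize k K ≤ 2 ^ k * (256 * 41943051 * K ^ 10) := by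
    unfold correlationSize oracleCount
    refine Nat.mul_le_mul_left _ ?_
    have : 1 ≤ K ^ 8 := Nat.one_le_pow _ _ hK
    calc 256 * K ^ 2 * (K * (41943040 * K ^ 7) + 11)
        ≤ 256 * K ^ 2 * (K * (41943040 * K ^ 7) + 11 * K ^ 8) := by gcongr; omega
      _ = _ := by ring
  have h3 : testSize K * 3 ≤ 2 ^ k * (3 * 10240 * 41943040 * K ^ 10) := by
    refine le_trans ?_ (Nat.le_mul_of_pos_left _ h2)
    unfold testSize oracleCount
    calc 10240 * K ^ 2 * (41943040 * K ^ 7) * 3 = 3 * 10240 * 41943040 * K ^ 9 := by ring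
      _ ≤ _ := by gcongr; omega
  have h4 : oracleCount K * (2 * averagingSize K) = 41943040 * 32768 * K ^ 10 := by
    unfold oracleCount averagingSize; ring
  have h5 : K ^ 10 ≤ K ^ 20 := Nat.pow_le_pow_right hK (by norm_num)
  unfold queryBound
  rw [h4]
  calc correlationSize k K + (correlationSize k K + testSize K * 3) *
        (41943040 * 32768 * K ^ 10)
      ≤ 2 ^ k * (256 * 41943051 * K ^ 10) + (2 ^ k * (256 * 41943051 * K ^ 10) +
        2 ^ k * (3 * 10240 * 41943040 * K ^ 10)) * (41943040 * 32768 * K ^ 10) := by gcongr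
    _ = 2 ^ k * (256 * 41943051 * K ^ 10 + (256 * 41943051 + 3 * 10240 * 41943040) *
        (41943040 * 32768) * K ^ 20) := by ring
    _ ≤ 2 ^ k * (256 * 41943051 * K ^ 20 + (256 * 41943051 + 3 * 10240 * 41943040) *
        (41943040 * 32768) * K ^ 20) := by gcongr
    _ = 2 ^ k * ((256 * 41943051 + (256 * 41943051 + 3 * 10240 * 41943040) *
        (41943040 * 32768)) * K ^ 20) := by ring
    _ ≤ _ := by gcongr; norm_num

lemma exists_tolerantTester (n : ℕ) {cu cl : ℝ} (hε : cu - cl ≤ 1) (hkK : k + 1 ≤ K)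
    (hKε : k + 1 ≤ K * (cu - cl)) :
    ∃ T : RandomizedQueryAlgorithm n, T.MakesAtMost (queryBound k K) ∧
      IsTolerantTester cu cl (juntas n k) T := by
  obtain ⟨T, hT, hprob⟩ := exists_randomizedQueryAlgorithm
    (fun ω : Seed n k K => verdict k K (1 - cu - cl) ω) testerQueries card_testerQueries_le
    (fun ω f f' h => decide_eq_decide.2
      ⟨accepts_congr h, accepts_congr fun x hx => (h x hx).symm⟩)
  have h23 : (2 / 3 : ENNReal) = ENNReal.ofReal (2 / 3) := by
    rw [ENNReal.ofReal_div_of_pos (by norm_num)]; norm_num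
  refine ⟨T, hT, fun f => ⟨?_, fun hf => ?_⟩⟩
  · rintro ⟨g, hg, hfg⟩
    rw [hprob, h23]
    exact ENNReal.ofReal_le_ofReal (le_pr_verdict_true hε hkK hKε hg hfg)
  · rw [hprob, h23]
    exact ENNReal.ofReal_le_ofReal (le_pr_verdict_false hε hkK hKε hf)

end Tester

end JuntaTesting

theorem corollary3 :
    ∃ p : MvPolynomial (Fin 2) ℝ,
      ∀ (cu cl : ℝ), 0 ≤ cl → cl < cu → cu < 1 / 2 → ∀ k : ℕ,
        ∃ q : ℕ, (q : ℝ) ≤ 2 ^ k * MvPolynomial.eval ![(k : ℝ), 1 / (cu - cl)] p ∧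
          ∃ T : (n : ℕ) → JuntaTesting.RandomizedQueryAlgorithm n,
            ∀ n : ℕ, (T n).MakesAtMost q ∧
              JuntaTesting.IsTolerantTester cu cl (JuntaTesting.juntas n k) (T n) := by
  refine ⟨MvPolynomial.C (10 ^ 26) *
    ((MvPolynomial.X 0 + 1) * (MvPolynomial.X 1 + 1)) ^ 20, fun cu cl hcl hlt hcu k => ?_⟩
  have hε : 0 < cu - cl := sub_pos.2 hlt
  set e := ⌈1 / (cu - cl)⌉₊ with he
  have he1 : 1 / (cu - cl) ≤ e := Nat.le_ceil _
  have he2 : (e : ℝ) < 1 / (cu - cl) + 1 := Nat.ceil_lt_add_one (by positivity)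
  have he0 : 1 ≤ e := Nat.ceil_pos.2 (by positivity)
  -- This single scale dominates `k + 1` and satisfies `K * (cu - cl) ≥ k + 1`, so `k` losses of
  -- order `1 / K` stay within the gap; it is also at most `(k + 1) * (1 / (cu - cl) + 1)`, the base
  -- of the polynomial.
  set K := (k + 1) * e with hK
  have hkK : k + 1 ≤ K := Nat.le_mul_of_pos_right _ he0
  have hKε : (k : ℝ) + 1 ≤ K * (cu - cl) := by
    have : 1 ≤ e * (cu - cl) := (div_le_iff₀ hε).1 he1
    rw [hK]; push_cast
    rw [mul_assoc]
    exact le_mul_of_one_le_right (by positivity) this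
  refine ⟨JuntaTesting.queryBound k K, ?_, ?_⟩
  · have h1 : (JuntaTesting.queryBound k K : ℝ) ≤ 2 ^ k * (10 ^ 26 * (K : ℝ) ^ 20) := by
      exact_mod_cast JuntaTesting.queryBound_le (k := k) (K := K) (by omega)
    refine h1.trans ?_
    simp only [map_mul, map_pow, map_add, map_one, MvPolynomial.eval_C, MvPolynomial.eval_X,
      Matrix.cons_val_zero, Matrix.cons_val_one]
    have h2 : (K : ℝ) ≤ (k + 1) * (1 / (cu - cl) + 1) := by
      rw [hK]; push_cast
      gcongr
    gcongr
  · choose T hT using fun n => JuntaTesting.exists_tolerantTester (k := k) (K := K) n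
      (by linarith : cu - cl ≤ 1) hkK hKε
    exact ⟨T, hT⟩
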